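/- Let $0<\delta<1$. For a compact set $E\subset\mathbb{R}$ that is a finite union of nondegenerate closed intervals, let $g_E:\mathbb{C}\to[0,\infty)$ be the Green function of $\overline{\mathbb{C}}\setminus E$ with pole at $\infty$, i.e. the unique continuous function on $\mathbb{C}$ that is harmonic on $\mathbb{C}\setminus E$, vanishes on $E$, and is such that $g_E(z)-\log|z|$ is bounded as $z\to\infty$. Write $G_{\alpha,\delta}=g_{E(\alpha,\delta)}$ with $E(\alpha,\delta)=[-1,1]\setminus(\alpha-\delta,\alpha+\delta)$, $|\alpha|<1-\delta$, and $G_\delta=g_{[-1+2\delta,1]}$, and put $$\Phi_\delta(x)=\sup_{\alpha\in(\delta-1,0]}G_{\alpha,\delta}(x).$$ (i) For $x\in[-1,0]$, $$G_\delta(x)=\log\left(\frac{\delta-x}{1-\delta}+\sqrt{\Big(\frac{\delta-x}{1-\delta}\Big)^2-1}\right)\ \text{ if } x\le -1+2\delta,\qquad G_\delta(x)=0\ \text{ if } x\ge-1+2\delta .$$ (ii) For every $\alpha\in(\delta-1,0]$ the equation $\partial_\alpha G_{\alpha,\delta}(x)=0$ has exactly one solution $x=x_0(\alpha)$ in the gap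 $(\alpha-\delta,\alpha+\delta)$. (iii) On $(-1,0]$ the function $\Phi_\delta$ is the upper envelope of the curve $y=G_\delta(x)$ and of the parametric curve $x=x_0(\alpha)$, $y=G_{\alpha,\delta}(x_0(\alpha))$, $\alpha\in(-1+\delta,0]$; that is, for every $x\in(-1,0]$, $\Phi_\delta(x)$ is the greatest element of $$\{G_\delta(x)\}\cup\{G_{\alpha,\delta}(x_0(\alpha)):\ \alpha\in(-1+\delta,0],\ x_0(\alpha)=x\}.$$ At the end point $x=-1$ this holds in the sense of a limit: $\lim_{x\to-1^+}\Phi_\delta(x)=G_\delta(-1)$. (iv) The end points of the second curve are $\left(0,\frac12\log\frac{1+\delta}{1-\delta}\right)$ and $(-1+2\delta,0)$: one has $x_0(0)=0$ and $G_{0,\delta}(0)=\frac12\log\frac{1+\delta}{1-\delta}$, while $x_0(\alpha)\to-1+2\delta$ and $G_{\alpha,\delta}(x_0(\alpha))\to0$ as $\alpha\to-1+\delta$, $\alpha>-1+\delta$. -/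

import Mathlib

open Set Filter Topology

namespace RemezEnvelope

/-- `g` is the Green function with pole at `∞` of the domain `ℂ̄ ∖ E` (with regular boundary),
extended by `0` to `E`: it is harmonic off `E`, vanishes continuously on `E`, and
`g z - log ‖z‖` stays bounded as `z → ∞`. -/
structure IsGreenFunction (E : Set ℂ) (g : ℂ → ℝ) : Prop where
  harmonic : InnerProductSpace.HarmonicOnNhd g Eᶜ
  continuous : Continuous g
  zero_on : ∀ z ∈ E, g z = 0
  pole : (fun z => g z - Real.log ‖z‖) =O[Bornology.cobounded ℂ] (fun _ => (1 : ℝ))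

open Classical in
/-- The Green function of `ℂ̄ ∖ E` with pole at `∞` (it is unique when it exists;
the value `0` is used when there is none). -/
noncomputable def greenFunction (E : Set ℂ) : ℂ → ℝ :=
  if h : ∃ g, IsGreenFunction E g then h.choose else 0

/-- The set `E(α, δ) = [-1, 1] ∖ (α - δ, α + δ)`. -/
def twoIntervals (α δ : ℝ) : Set ℝ := Icc (-1) 1 \ Ioo (α - δ) (α + δ)

/-- `G_{α,δ}`, on the real line. -/
noncomputable def greenTwo (α δ x : ℝ) : ℝ :=
  greenFunction ((fun t : ℝ => (t : ℂ)) '' twoIntervals α δ) (x : ℂ)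

/-- `G_δ`, the Green function of the complement of `[-1 + 2δ, 1]`, on the real line. -/
noncomputable def greenOne (δ x : ℝ) : ℝ :=
  greenFunction ((fun t : ℝ => (t : ℂ)) '' Icc (-1 + 2 * δ) 1) (x : ℂ)

/-- `Φ_δ(x) = sup_{α ∈ (δ - 1, 0]} G_{α,δ}(x)`. -/
noncomputable def Phi (δ x : ℝ) : ℝ :=
  sSup ((fun α => greenTwo α δ x) '' Ioc (δ - 1) 0)

/-- `x` lies in the gap `(α - δ, α + δ)` and solves `∂_α G_{α,δ}(x) = 0`. -/
def IsGapCritical (δ α x : ℝ) : Prop :=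
  x ∈ Ioo (α - δ) (α + δ) ∧ HasDerivAt (fun β => greenTwo β δ x) 0 α

end RemezEnvelope

namespace RemezEnvelope

/-!
In the upper half plane the Green function of the complement of finitely many intervals is the real
part of a primitive of `p(z) / ∏ √(z - e)`, where `e` runs over the end points and the monic
polynomial `p` has one zero in each gap; it extends evenly across the real line, and the maximum
principle gives uniqueness. In the gap of `[-1, 1] ∖ (α - δ, α + δ)` the substitution
`t = α + δ cos θ` turns this into `G(α + δ cos φ) = ∫ θ in φ..π, (c - t) / √(1 - t²)` with `c` the
critical point. The gap no longer moves with `α` here, so the integral can be differentiated in `α`;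
the derivative at a fixed point of the gap is strictly decreasing in `φ` and tends to `±∞` at the
ends of the gap, whence the unique zero `x₀(α)`.

As `α → δ - 1` the left interval collapses and `G_{α,δ}` tends to `G_δ`. Since the Green function
decreases in the set, `G_{α,δ}` is at most the Green function of the complement of `[α + δ, 1]`,
which also tends to `G_δ`; so a supremum larger than `G_δ(x)` is attained, either at an interior
`α`, where the derivative vanishes, or at `α = 0`, where the derivative must be nonnegative, that
is, `x ≥ 0 = x₀(0)`. Finally `∂c/∂α → ∞` as `α → δ - 1`, so the derivative is eventually negative at
every fixed `x`, which forces `x₀(α) → -1 + 2δ`.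
-/

open Bornology InnerProductSpace Polynomial UpperHalfPlane

/-! ### The maximum principle and uniqueness of Green functions -/

theorem eventually_eq_of_isLocalMax_of_harmonicAt {u : ℂ → ℝ} {z : ℂ} (hu : HarmonicAt u z)
    (hz : IsLocalMax u z) : ∀ᶠ w in 𝓝 z, u w = u z := by
  obtain ⟨r, hr, hball⟩ := Metric.eventually_nhds_iff_ball.1 hu.eventually
  obtain ⟨F, hF, hFu⟩ := HarmonicOnNhd.exists_analyticOnNhd_ball_re_eq hball
  have hmem : ∀ᶠ w in 𝓝 z, w ∈ Metric.ball z r := Metric.ball_mem_nhds z hr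
  have hnorm : ∀ w ∈ Metric.ball z r, ‖Complex.exp (F w)‖ = Real.exp (u w) := fun w hw => by
    rw [Complex.norm_exp, ← hFu hw]
  have hzr := hnorm z (Metric.mem_ball_self hr)
  have hmax : IsLocalMax (norm ∘ fun w => Complex.exp (F w)) z := by
    filter_upwards [hmem, hz] with w hw hwz
    simpa only [Function.comp_apply, hnorm w hw, hzr] using Real.exp_le_exp.2 hwz
  have hdiff : ∀ᶠ w in 𝓝 z, DifferentiableAt ℂ (fun w => Complex.exp (F w)) w :=
    hmem.mono fun w hw => (hF w hw).differentiableAt.cexp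
  filter_upwards [Complex.norm_eventually_eq_of_isLocalMax hdiff hmax, hmem] with w hw hwr
  rw [hnorm w hwr, hzr] at hw
  exact Real.exp_injective hw

theorem nonpos_of_harmonicOnNhd_compl {E : Set ℂ} {u : ℂ → ℝ} (hc : Continuous u)
    (hu : HarmonicOnNhd u Eᶜ) (hE : ∀ z ∈ E, u z ≤ 0)
    (hinf : ∀ᶠ z in cobounded ℂ, u z ≤ 0) (z : ℂ) : u z ≤ 0 := by
  by_contra! hz
  have hz' : {w | u w < u z} ∈ cocompact ℂ := by
    rw [← Metric.cobounded_eq_cocompact]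
    exact hinf.mono fun w hw => hw.trans_lt hz
  obtain ⟨m, hm⟩ := hc.exists_forall_ge' z (Filter.mem_of_superset hz' fun _ hw => le_of_lt hw)
  have hclopen : IsClopen {w | u w = u m} := by
    refine ⟨isClosed_eq hc continuous_const, isOpen_iff_mem_nhds.2 fun w (hw : u w = u m) => ?_⟩
    have hwE : w ∈ Eᶜ := fun h => by linarith [hE w h, hm z]
    have hmax : IsLocalMax u w := Eventually.of_forall fun v => (hm v).trans_eq hw.symm
    filter_upwards [eventually_eq_of_isLocalMax_of_harmonicAt (hu w hwE) hmax] with v hv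
    exact hv.trans hw
  obtain ⟨w, hw⟩ := hinf.exists
  have hwm : u w = u m := (hclopen.eq_univ ⟨m, rfl⟩).ge (mem_univ w)
  linarith [hm z]

namespace IsGreenFunction

variable {E E₁ E₂ : Set ℂ} {g g₁ g₂ : ℂ → ℝ}

theorem exists_abs_sub_log_le (h : IsGreenFunction E g) :
    ∃ C, ∀ᶠ z in cobounded ℂ, |g z - Real.log ‖z‖| ≤ C := by
  simpa [Asymptotics.isBigO_iff] using h.pole

theorem tendsto_atTop (h : IsGreenFunction E g) : Tendsto g (cobounded ℂ) atTop := by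
  obtain ⟨C, hC⟩ := h.exists_abs_sub_log_le
  refine tendsto_atTop_mono' _ ?_ (tendsto_atTop_add_const_left _ (-C)
    (Real.tendsto_log_atTop.comp tendsto_norm_cobounded_atTop))
  filter_upwards [hC] with z hz
  rw [Function.comp_apply]
  linarith [(abs_le.1 hz).1]

theorem nonneg (h : IsGreenFunction E g) (z : ℂ) : 0 ≤ g z :=
  neg_nonpos.1 <| nonpos_of_harmonicOnNhd_compl h.continuous.neg h.harmonic.neg
    (fun w hw => by simp [h.zero_on w hw])
    ((h.tendsto_atTop.eventually_ge_atTop 0).mono fun _ => neg_nonpos.2) z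

/- A multiple `1 + ε > 1` of `g₁` dominates `g₂` near infinity, so the maximum principle applies;
then let `ε → 0`. -/
theorem le_of_subset (h₁ : IsGreenFunction E₁ g₁) (h₂ : IsGreenFunction E₂ g₂)
    (hE : E₁ ⊆ E₂) (z : ℂ) : g₂ z ≤ g₁ z := by
  have hε : ∀ ε > 0, g₂ z - (1 + ε) * g₁ z ≤ 0 := fun ε hε => by
    refine nonpos_of_harmonicOnNhd_compl (E := E₂) (u := fun w => g₂ w - (1 + ε) * g₁ w)
      (h₂.continuous.sub (continuous_const.mul h₁.continuous))
      (h₂.harmonic.sub ((h₁.harmonic.mono (compl_subset_compl.2 hE)).const_smul (c := 1 + ε)))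
      (fun w hw => ?_) ?_ z
    · have := h₁.nonneg w
      rw [h₂.zero_on w hw, zero_sub, neg_nonpos]
      positivity
    · obtain ⟨C₁, hC₁⟩ := h₁.exists_abs_sub_log_le
      obtain ⟨C₂, hC₂⟩ := h₂.exists_abs_sub_log_le
      filter_upwards [hC₁, hC₂, h₁.tendsto_atTop.eventually_ge_atTop ((C₁ + C₂) / ε)]
        with w hw₁ hw₂ hw
      rw [div_le_iff₀ hε] at hw
      linarith [(abs_le.1 hw₁).1, (abs_le.1 hw₂).2]
  have hlim : Tendsto (fun ε : ℝ => g₂ z - (1 + ε) * g₁ z) (𝓝[>] 0) (𝓝 (g₂ z - g₁ z)) := by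
    have hc : Continuous fun ε : ℝ => g₂ z - (1 + ε) * g₁ z := by fun_prop
    simpa using (hc.tendsto 0).mono_left nhdsWithin_le_nhds
  exact sub_nonpos.1 (le_of_tendsto hlim (eventually_mem_nhdsWithin.mono hε))

theorem greenFunction_eq (h : IsGreenFunction E g) : greenFunction E = g := by
  have hex : ∃ g, IsGreenFunction E g := ⟨g, h⟩
  rw [greenFunction, dif_pos hex]
  exact funext fun z => le_antisymm (h.le_of_subset hex.choose_spec subset_rfl z)
    (hex.choose_spec.le_of_subset h subset_rfl z)

end IsGreenFunction

/-! ### The square root on the closed upper half plane -/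

/-- The branch of the square root that maps the closed upper half plane into the first quadrant;
its cut is the negative imaginary axis. -/
noncomputable def upperSqrt (z : ℂ) : ℂ :=
  (1 + Complex.I) / (√2 : ℝ) * (-Complex.I * z) ^ (2⁻¹ : ℂ)

theorem upperSqrt_sq (z : ℂ) : upperSqrt z ^ 2 = z := by
  rw [upperSqrt, mul_pow, Complex.cpow_ofNat_inv_pow, div_pow, ← Complex.ofReal_pow,
    Real.sq_sqrt zero_le_two, Complex.ofReal_ofNat]
  linear_combination ((-z) - Complex.I * z / 2) * Complex.I_sq

theorem upperSqrt_eq_zero_iff {z : ℂ} : upperSqrt z = 0 ↔ z = 0 := by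
  rw [← sq_eq_zero_iff, upperSqrt_sq]

theorem norm_upperSqrt (z : ℂ) : ‖upperSqrt z‖ = √‖z‖ := by
  rw [← Real.sqrt_sq (norm_nonneg (upperSqrt z)), ← norm_pow, upperSqrt_sq]

theorem upperSqrt_nonneg {z : ℂ} (hz : 0 ≤ z.im) : 0 ≤ (upperSqrt z).re ∧ 0 ≤ (upperSqrt z).im := by
  set w := (-Complex.I * z) ^ (2⁻¹ : ℂ) with hw
  have hwabs : |w.im| ≤ w.re := by
    rw [hw, Complex.abs_cpow_inv_two_im, Complex.cpow_inv_two_re]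
    have hre : (-Complex.I * z).re = z.im := by simp
    rw [hre]
    gcongr
    linarith
  obtain ⟨hlow, hhigh⟩ := abs_le.1 hwabs
  have hz : upperSqrt z = (1 + Complex.I) * w / (√2 : ℝ) := by rw [upperSqrt, ← hw]; ring
  rw [hz, Complex.div_ofReal_re, Complex.div_ofReal_im]
  simp only [Complex.mul_re, Complex.mul_im, Complex.add_re, Complex.add_im, Complex.one_re,
    Complex.one_im, Complex.I_re, Complex.I_im, add_zero, zero_add, one_mul]
  constructor <;> exact div_nonneg (by linarith) (Real.sqrt_nonneg 2)

theorem upperSqrt_pos {z : ℂ} (hz : 0 < z.im) : 0 < (upperSqrt z).re ∧ 0 < (upperSqrt z).im := by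
  obtain ⟨hre, him⟩ := upperSqrt_nonneg hz.le
  have h := congrArg Complex.im (upperSqrt_sq z)
  rw [sq, Complex.mul_im] at h
  constructor
  · refine hre.lt_of_ne fun h0 => ?_
    simp [← h0, hz.ne] at h
  · refine him.lt_of_ne fun h0 => ?_
    simp [← h0, hz.ne] at h

theorem upperSqrt_eq_of_sq_eq {z w : ℂ} (hw : w ^ 2 = z) (hre : 0 ≤ w.re) (him : 0 ≤ w.im) :
    upperSqrt z = w := by
  have hz : 0 ≤ z.im := by
    rw [← hw, sq, Complex.mul_im]
    positivity
  have hsq : upperSqrt z ^ 2 = w ^ 2 := by rw [upperSqrt_sq, hw]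
  rcases sq_eq_sq_iff_eq_or_eq_neg.1 hsq with h | h
  · exact h
  · obtain ⟨hre', him'⟩ := upperSqrt_nonneg hz
    rw [h, Complex.neg_re, neg_nonneg] at hre'
    rw [h, Complex.neg_im, neg_nonneg] at him'
    have hw0 : w = 0 := Complex.ext (le_antisymm hre' hre) (le_antisymm him' him)
    rw [h, hw0, neg_zero]

theorem upperSqrt_ofReal_of_nonneg {x : ℝ} (hx : 0 ≤ x) : upperSqrt x = √x :=
  upperSqrt_eq_of_sq_eq (by exact_mod_cast Real.sq_sqrt hx) (by simp) (by simp)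

theorem upperSqrt_ofReal_of_nonpos {x : ℝ} (hx : x ≤ 0) : upperSqrt x = Complex.I * √(-x) := by
  refine upperSqrt_eq_of_sq_eq ?_ (by simp) (by simp)
  rw [mul_pow, Complex.I_sq, ← Complex.ofReal_pow, Real.sq_sqrt (neg_nonneg.2 hx)]
  simp

theorem hasDerivAt_upperSqrt {z : ℂ} (hz : 0 < z.im ∨ z.re ≠ 0) :
    HasDerivAt upperSqrt (2 * upperSqrt z)⁻¹ z := by
  have hslit : -Complex.I * z ∈ Complex.slitPlane := by
    simpa [Complex.mem_slitPlane_iff] using hz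
  have hdiff : DifferentiableAt ℂ upperSqrt z :=
    (((differentiableAt_id.const_mul (-Complex.I)).cpow_const hslit).const_mul _)
  have hsq := hdiff.hasDerivAt.fun_pow 2
  simp only [upperSqrt_sq, Nat.cast_ofNat, Nat.add_one_sub_one, pow_one] at hsq
  have hderiv : 2 * upperSqrt z * deriv upperSqrt z = 1 := hsq.unique (hasDerivAt_id z)
  exact hdiff.hasDerivAt.congr_deriv (eq_inv_of_mul_eq_one_right hderiv)

theorem continuousAt_upperSqrt_zero : ContinuousAt upperSqrt 0 := by
  rw [ContinuousAt, upperSqrt_eq_zero_iff.2 rfl, tendsto_zero_iff_norm_tendsto_zero]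
  simp only [norm_upperSqrt]
  have : Continuous fun z : ℂ => √‖z‖ := by fun_prop
  simpa using this.tendsto 0

theorem upperSqrt_sub_ofReal {z : ℂ} (hz : 0 < z.im) (e : ℝ) :
    upperSqrt (z - e) = upperSqrt z * (1 - e / z) ^ (2⁻¹ : ℂ) := by
  have hz0 : z ≠ 0 := fun h => by simp [h] at hz
  have hsq : upperSqrt (z - e) ^ 2 = (upperSqrt z * (1 - e / z) ^ (2⁻¹ : ℂ)) ^ 2 := by
    rw [mul_pow, upperSqrt_sq, upperSqrt_sq, Complex.cpow_ofNat_inv_pow]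
    field_simp
  refine (sq_eq_sq_iff_eq_or_eq_neg.1 hsq).resolve_right fun h => ?_
  have hquot : (1 - e / z) ^ (2⁻¹ : ℂ) = -(upperSqrt (z - e) / upperSqrt z) := by
    rw [h, neg_div, neg_neg, mul_div_cancel_left₀ _ (upperSqrt_eq_zero_iff.not.2 hz0)]
  have hre : 0 ≤ ((1 - e / z) ^ (2⁻¹ : ℂ)).re := by
    rw [Complex.cpow_inv_two_re]
    exact Real.sqrt_nonneg _
  obtain ⟨hzre, hzim⟩ := upperSqrt_pos hz
  obtain ⟨here, heim⟩ := upperSqrt_pos (z := z - e) (by simpa using hz)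
  have hpos : 0 < (upperSqrt (z - e) / upperSqrt z).re := by
    have := Complex.normSq_pos.2 (upperSqrt_eq_zero_iff.not.2 hz0)
    rw [Complex.div_re]
    positivity
  rw [hquot, Complex.neg_re] at hre
  linarith

/-! ### Boundary behaviour of primitives -/

section Primitive

variable {U : Set ℂ} {F P R : ℂ → ℂ} {x : ℂ}

theorem exists_eventuallyEq_add_const (hU : IsOpen U) (hUc : Convex ℝ U)
    (hF : ∀ᶠ z in 𝓝[U] x, HasDerivAt F (R z) z) (hP : ∀ᶠ z in 𝓝[U] x, HasDerivAt P (R z) z) :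
    ∃ k, ∀ᶠ z in 𝓝[U] x, F z = P z + k := by
  obtain ⟨r, hr, hball⟩ := Metric.mem_nhdsWithin_iff.1 (hF.and hP)
  obtain ⟨k, hk⟩ := (Metric.isOpen_ball.inter hU).exists_eq_add_of_deriv_eq
    ((convex_ball x r).inter hUc).isPreconnected
    (fun z hz => (hball hz).1.differentiableAt.differentiableWithinAt)
    (fun z hz => (hball hz).2.differentiableAt.differentiableWithinAt)
    (fun z hz => (hball hz).1.deriv.trans (hball hz).2.deriv.symm)
  exact ⟨k, mem_of_superset
    (inter_mem (mem_nhdsWithin_of_mem_nhds (Metric.ball_mem_nhds x hr)) self_mem_nhdsWithin) hk⟩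

theorem exists_eventually_hasDerivAt (hR : AnalyticAt ℂ R x) :
    ∃ P : ℂ → ℂ, ∀ᶠ z in 𝓝 x, HasDerivAt P (R z) z := by
  obtain ⟨r, hr, hball⟩ := hR.exists_ball_analyticOnNhd
  obtain ⟨P, hP⟩ := hball.differentiableOn.isExactOn_ball
  exact ⟨P, mem_of_superset (Metric.ball_mem_nhds x hr) hP⟩

theorem analyticAt_of_eventually_hasDerivAt (hP : ∀ᶠ z in 𝓝 x, HasDerivAt P (R z) z) :
    AnalyticAt ℂ P x :=
  Complex.analyticAt_iff_eventually_differentiableAt.2 (hP.mono fun _ h => h.differentiableAt)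

theorem exists_primitive_eventuallyEq (hU : IsOpen U) (hUc : Convex ℝ U)
    (hF : ∀ z ∈ U, HasDerivAt F (R z) z) (hR : AnalyticAt ℂ R x) :
    ∃ P : ℂ → ℂ, (∀ᶠ z in 𝓝 x, HasDerivAt P (R z) z) ∧ F =ᶠ[𝓝[U] x] P := by
  obtain ⟨P, hP⟩ := exists_eventually_hasDerivAt hR
  obtain ⟨k, hk⟩ := exists_eventuallyEq_add_const hU hUc (eventually_nhdsWithin_of_forall hF)
    (hP.filter_mono nhdsWithin_le_nhds)
  exact ⟨fun z => P z + k, hP.mono fun z hz => hz.add_const k, hk⟩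

theorem exists_primitive_upperHalfPlane (hR : DifferentiableOn ℂ R upperHalfPlaneSet) :
    ∃ F : ℂ → ℂ, ∀ z ∈ upperHalfPlaneSet, HasDerivAt F (R z) z := by
  obtain ⟨F, hF⟩ := (convex_halfSpace_im_gt 0).exists_forall_hasDerivWithinAt hR
  exact ⟨F, fun z hz => (hF z hz).hasDerivAt (isOpen_upperHalfPlaneSet.mem_nhds hz)⟩

end Primitive

section HalfPlane

variable {F R : ℂ → ℂ}

/- In the coordinate `w = upperSqrt (z - e)` the differential `R dz = 2 A(e + w²) dw` is regular. -/
theorem exists_tendsto_of_div_upperSqrt {A : ℂ → ℂ} {e : ℝ}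
    (hF : ∀ z ∈ upperHalfPlaneSet, HasDerivAt F (R z) z) (hA : AnalyticAt ℂ A e)
    (hR : ∀ z ∈ upperHalfPlaneSet, R z = A z / upperSqrt (z - e)) :
    ∃ y, Tendsto F (𝓝[upperHalfPlaneSet] e) (𝓝 y) := by
  have hA' : AnalyticAt ℂ (fun w => 2 * A (e + w ^ 2)) 0 :=
    analyticAt_const.mul (AnalyticAt.fun_comp (by simpa using hA) (by fun_prop))
  obtain ⟨B, hB⟩ := exists_eventually_hasDerivAt hA'
  have hw : Tendsto (fun z : ℂ => upperSqrt (z - e)) (𝓝[upperHalfPlaneSet] e) (𝓝 0) := by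
    have hsub : Tendsto (fun z : ℂ => z - e) (𝓝 e) (𝓝 0) := by
      simpa using (continuous_sub_right (e : ℂ)).tendsto e
    have := continuousAt_upperSqrt_zero.tendsto.comp hsub
    rw [upperSqrt_eq_zero_iff.2 rfl] at this
    exact this.mono_left nhdsWithin_le_nhds
  have hBw : ∀ᶠ z in 𝓝[upperHalfPlaneSet] (e : ℂ),
      HasDerivAt (fun z => B (upperSqrt (z - e))) (R z) z := by
    filter_upwards [hw.eventually hB, self_mem_nhdsWithin] with z hBz hz
    have him : 0 < (z - e).im := by simpa using hz
    have hne : upperSqrt (z - e) ≠ 0 := fun h => by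
      rw [upperSqrt_eq_zero_iff] at h
      simp [h] at him
    refine (hBz.comp z ((hasDerivAt_upperSqrt (Or.inl him)).comp_sub_const z e)).congr_deriv ?_
    rw [hR z hz, upperSqrt_sq, add_sub_cancel]
    field_simp
  obtain ⟨k, hk⟩ := exists_eventuallyEq_add_const isOpen_upperHalfPlaneSet
    (convex_halfSpace_im_gt 0) (eventually_nhdsWithin_of_forall hF) hBw
  have hB0 := (analyticAt_of_eventually_hasDerivAt hB).continuousAt.tendsto
  exact ⟨B 0 + k, ((hB0.comp hw).add_const k).congr' (hk.mono fun z hz => hz.symm)⟩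

theorem neg_inv_mem_upperHalfPlaneSet {z : ℂ} (hz : z ∈ upperHalfPlaneSet) :
    -z⁻¹ ∈ upperHalfPlaneSet := by
  have hz' : 0 < z.im := hz
  have := Complex.normSq_pos.2 (fun h => by simp [h] at hz' : z ≠ 0)
  have him : 0 < z.im / Complex.normSq z := by positivity
  simpa [Complex.inv_im, neg_div] using him

theorem tendsto_neg_inv_cobounded_upperHalfPlaneSet :
    Tendsto (fun z : ℂ => -z⁻¹) (cobounded ℂ ⊓ 𝓟 upperHalfPlaneSet) (𝓝[upperHalfPlaneSet] 0) := by
  refine tendsto_nhdsWithin_iff.2 ⟨?_, eventually_inf_principal.2 <|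
    Eventually.of_forall fun z => neg_inv_mem_upperHalfPlaneSet⟩
  simpa using (tendsto_inv₀_cobounded (α := ℂ)).neg.mono_left inf_le_left

theorem hasDerivAt_comp_neg_inv {A : ℂ → ℂ} {u : ℂ}
    (hF : ∀ z ∈ upperHalfPlaneSet, HasDerivAt F (R z) z)
    (hR : ∀ z ∈ upperHalfPlaneSet, R z = A z⁻¹ / z) (hu : u ∈ upperHalfPlaneSet) :
    HasDerivAt (fun u => F (-u⁻¹)) (-A (-u) / u) u := by
  have hu0 : u ≠ 0 := fun h => by simp [h] at hu
  refine ((hF _ (neg_inv_mem_upperHalfPlaneSet hu)).comp u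
    (hasDerivAt_inv hu0).neg).congr_deriv ?_
  rw [hR _ (neg_inv_mem_upperHalfPlaneSet hu), inv_neg, inv_inv]
  field_simp

/- In the coordinate `u = -1 / z` the differential `R dz = -A(-u) / u du` has a simple pole at `0`
with residue `-1`. -/
theorem isBigO_re_sub_log {A : ℂ → ℂ} (hF : ∀ z ∈ upperHalfPlaneSet, HasDerivAt F (R z) z)
    (hA : AnalyticAt ℂ A 0) (hA0 : A 0 = 1)
    (hR : ∀ z ∈ upperHalfPlaneSet, R z = A z⁻¹ / z) :
    (fun z => (F z).re - Real.log ‖z‖) =O[cobounded ℂ ⊓ 𝓟 upperHalfPlaneSet]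
      (fun _ => (1 : ℝ)) := by
  have hslope : AnalyticAt ℂ (dslope A 0) 0 :=
    let ⟨_, hp⟩ := hA
    hp.has_fpower_series_dslope_fslope.analyticAt
  obtain ⟨B, hB⟩ := exists_eventually_hasDerivAt hslope
  have hneg : Tendsto (fun u : ℂ => -u) (𝓝[upperHalfPlaneSet] 0) (𝓝 0) := by
    simpa using (continuous_neg.tendsto (0 : ℂ)).mono_left nhdsWithin_le_nhds
  have hlog : ∀ᶠ u in 𝓝[upperHalfPlaneSet] (0 : ℂ),
      HasDerivAt (fun u => -Complex.log u - B (-u)) (-A (-u) / u) u := by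
    filter_upwards [hneg.eventually hB, self_mem_nhdsWithin] with u hBu hu
    have hu' : 0 < u.im := hu
    have hu0 : u ≠ 0 := fun h => by simp [h] at hu'
    refine ((Complex.hasDerivAt_log (Or.inr hu'.ne')).neg.sub
      (hBu.comp u (hasDerivAt_neg u))).congr_deriv ?_
    rw [dslope_of_ne _ (neg_ne_zero.2 hu0), slope_def_field, hA0, sub_zero]
    field_simp
    ring
  obtain ⟨k, hk⟩ := exists_eventuallyEq_add_const isOpen_upperHalfPlaneSet
    (convex_halfSpace_im_gt 0) (eventually_nhdsWithin_of_forall fun u hu =>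
      hasDerivAt_comp_neg_inv hF hR hu) hlog
  have hB0 := (analyticAt_of_eventually_hasDerivAt hB).continuousAt.tendsto.comp hneg
  have hlim : Tendsto (fun u => (-B (-u) + k).re) (𝓝[upperHalfPlaneSet] 0) (𝓝 (-B 0 + k).re) :=
    (Complex.continuous_re.tendsto _).comp (hB0.neg.add_const k)
  refine ((hlim.comp tendsto_neg_inv_cobounded_upperHalfPlaneSet).isBigO_one ℝ).congr' ?_
    EventuallyEq.rfl
  filter_upwards [tendsto_neg_inv_cobounded_upperHalfPlaneSet.eventually hk] with z hz
  rw [neg_inv, neg_neg, inv_inv] at hz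
  simp [hz, Complex.log_re]
  ring

end HalfPlane

/-! ### Even extension of a potential across the real line -/

/-- The reflection of the plane onto the closed upper half plane. -/
noncomputable def fold (z : ℂ) : ℂ := ⟨z.re, |z.im|⟩

theorem continuous_fold : Continuous fold := by
  have hfold : fold = fun z : ℂ => (z.re : ℂ) + (|z.im| : ℝ) * Complex.I :=
    funext fun z => Complex.ext (by simp [fold]) (by simp [fold])
  rw [hfold]
  fun_prop

theorem fold_of_im_nonneg {z : ℂ} (hz : 0 ≤ z.im) : fold z = z :=
  Complex.ext rfl (abs_of_nonneg hz)

theorem fold_of_im_nonpos {z : ℂ} (hz : z.im ≤ 0) : fold z = (starRingEnd ℂ) z :=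
  Complex.ext rfl (abs_of_nonpos hz)

theorem norm_fold (z : ℂ) : ‖fold z‖ = ‖z‖ := by
  rcases le_total 0 z.im with h | h
  · rw [fold_of_im_nonneg h]
  · rw [fold_of_im_nonpos h, Complex.norm_conj]

theorem fold_mem_closure_upperHalfPlaneSet (z : ℂ) : fold z ∈ closure upperHalfPlaneSet := by
  rw [Complex.closure_setOfPred_lt_im]
  exact abs_nonneg z.im

/-- The real part of `F`, extended from the open upper half plane first to its closure by
continuity and then to the whole plane as a function invariant under complex conjugation. -/
noncomputable def evenPotential (F : ℂ → ℂ) (z : ℂ) : ℝ :=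
  (extendFrom upperHalfPlaneSet F (fold z)).re

section EvenPotential

variable {F P R : ℂ → ℂ} {x : ℝ} {z : ℂ}

theorem continuous_evenPotential
    (hF : ∀ z ∈ closure upperHalfPlaneSet, ∃ y, Tendsto F (𝓝[upperHalfPlaneSet] z) (𝓝 y)) :
    Continuous (evenPotential F) :=
  Complex.continuous_re.comp <| (continuousOn_extendFrom subset_rfl hF).comp_continuous
    continuous_fold fold_mem_closure_upperHalfPlaneSet

theorem evenPotential_eventuallyEq (hP : AnalyticAt ℂ P (fold z))
    (hFP : F =ᶠ[𝓝[upperHalfPlaneSet] (fold z)] P) :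
    evenPotential F =ᶠ[𝓝 z] fun w => (P (fold w)).re := by
  have hext : ∀ᶠ w in 𝓝 (fold z), w ∈ closure upperHalfPlaneSet →
      extendFrom upperHalfPlaneSet F w = P w := by
    filter_upwards [eventually_nhds_nhdsWithin.2 hFP, hP.eventually_analyticAt] with w hw hPw hwc
    exact extendFrom_eq hwc <|
      (hPw.continuousAt.tendsto.mono_left nhdsWithin_le_nhds).congr' (EventuallyEq.symm hw)
  filter_upwards [continuous_fold.continuousAt.eventually hext] with w hw
  rw [evenPotential, hw (fold_mem_closure_upperHalfPlaneSet w)]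

theorem evenPotential_of_im_pos (hF : DifferentiableOn ℂ F upperHalfPlaneSet)
    (hz : 0 < z.im) :
    evenPotential F z = (F z).re := by
  rw [evenPotential, fold_of_im_nonneg hz.le,
    extendFrom_eq (A := upperHalfPlaneSet) (subset_closure hz)]
  exact (hF z hz).continuousWithinAt

theorem harmonicAt_evenPotential_of_im_ne_zero (hF : DifferentiableOn ℂ F upperHalfPlaneSet)
    (hz : z.im ≠ 0) : HarmonicAt (evenPotential F) z := by
  have han : ∀ w ∈ upperHalfPlaneSet, AnalyticAt ℂ F w := fun w hw =>
    hF.analyticAt (isOpen_upperHalfPlaneSet.mem_nhds hw)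
  have heq := evenPotential_eventuallyEq (han (fold z) (abs_pos.2 hz)) EventuallyEq.rfl
  refine (harmonicAt_congr_nhds heq).2 ?_
  rcases hz.lt_or_gt with hz | hz
  · have hconj : AnalyticAt ℂ ((starRingEnd ℂ) ∘ F ∘ (starRingEnd ℂ)) z := by
      refine DifferentiableOn.analyticAt (s := {w | w.im < 0}) (fun w hw => ?_)
        ((isOpen_lt Complex.continuous_im continuous_const).mem_nhds hz)
      have hw' : (starRingEnd ℂ) w ∈ upperHalfPlaneSet := by
        simpa using (show w.im < 0 from hw)
      have := (han _ hw').differentiableAt.conj_conj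
      rw [Complex.conj_conj] at this
      exact this.differentiableWithinAt
    refine (harmonicAt_congr_nhds ?_).1 hconj.harmonicAt_re
    filter_upwards [(isOpen_lt Complex.continuous_im continuous_const).mem_nhds hz] with w hw
    simp [fold_of_im_nonpos (le_of_lt hw)]
  · refine (harmonicAt_congr_nhds ?_).1 (han z hz).harmonicAt_re
    filter_upwards [isOpen_upperHalfPlaneSet.mem_nhds hz] with w hw
    rw [fold_of_im_nonneg (le_of_lt hw)]

theorem tendsto_ofReal_nhdsNE : Tendsto (fun t : ℝ => (t : ℂ)) (𝓝[≠] x) (𝓝[≠] (x : ℂ)) :=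
  Complex.continuous_ofReal.continuousAt.continuousWithinAt.tendsto_nhdsWithin fun t ht => by
    simpa using ht

theorem eventually_re_conj_eq (hP : ∀ᶠ z in 𝓝 (x : ℂ), HasDerivAt P (R z) z)
    (hR : ∀ᶠ t : ℝ in 𝓝 x, (R t).im = 0) :
    ∀ᶠ z in 𝓝 (x : ℂ), (P ((starRingEnd ℂ) z)).re = (P z).re := by
  have hconj : Tendsto (starRingEnd ℂ) (𝓝 (x : ℂ)) (𝓝 (x : ℂ)) := by
    simpa using Complex.continuous_conj.tendsto (x : ℂ)
  have hQ : ∀ᶠ z in 𝓝 (x : ℂ), HasDerivAt ((starRingEnd ℂ) ∘ P ∘ (starRingEnd ℂ))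
      ((starRingEnd ℂ) (R ((starRingEnd ℂ) z))) z := by
    filter_upwards [hconj.eventually hP] with z hz
    simpa using hz.conj_conj
  have hderiv : ∀ {Q S : ℂ → ℂ}, (∀ᶠ z in 𝓝 (x : ℂ), HasDerivAt Q (S z) z) →
      AnalyticAt ℂ S x := fun h =>
    (analyticAt_of_eventually_hasDerivAt h).deriv.congr (h.mono fun z hz => hz.deriv)
  have hRR : ∀ᶠ z in 𝓝 (x : ℂ), R z = (starRingEnd ℂ) (R ((starRingEnd ℂ) z)) := by
    refine ((hderiv hP).frequently_eq_iff_eventually_eq (hderiv hQ)).1 ?_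
    refine tendsto_ofReal_nhdsNE.frequently (Eventually.frequently ?_)
    filter_upwards [hR.filter_mono nhdsWithin_le_nhds] with t ht
    rw [Complex.conj_ofReal, Complex.conj_eq_iff_im.2 ht]
  have hQ' : ∀ᶠ z in 𝓝 (x : ℂ), HasDerivAt ((starRingEnd ℂ) ∘ P ∘ (starRingEnd ℂ)) (R z) z := by
    filter_upwards [hQ, hRR] with z hz hRz
    rwa [hRz]
  rw [← nhdsWithin_univ] at hP hQ'
  obtain ⟨k, hk⟩ := exists_eventuallyEq_add_const isOpen_univ convex_univ hQ' hP
  rw [nhdsWithin_univ] at hk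
  have hk0 : k.re = 0 := by simpa using congrArg Complex.re hk.self_of_nhds
  filter_upwards [hk] with z hz
  simpa [hk0] using congrArg Complex.re hz

theorem harmonicAt_evenPotential_ofReal (hF : ∀ z ∈ upperHalfPlaneSet, HasDerivAt F (R z) z)
    (hR : AnalyticAt ℂ R x) (hreal : ∀ᶠ t : ℝ in 𝓝 x, (R t).im = 0) :
    HarmonicAt (evenPotential F) x := by
  obtain ⟨P, hP, hFP⟩ := exists_primitive_eventuallyEq isOpen_upperHalfPlaneSet
    (convex_halfSpace_im_gt 0) hF hR
  have hPan := analyticAt_of_eventually_hasDerivAt hP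
  have hx : fold x = x := fold_of_im_nonneg (Complex.ofReal_im x).ge
  refine (harmonicAt_congr_nhds ?_).2 hPan.harmonicAt_re
  have heq := evenPotential_eventuallyEq (F := F) (z := x) (by rwa [hx]) (by rwa [hx])
  filter_upwards [heq, eventually_re_conj_eq hP hreal] with z hz hconj
  rw [hz]
  rcases le_total 0 z.im with h | h
  · rw [fold_of_im_nonneg h]
  · rw [fold_of_im_nonpos h, hconj]

theorem hasDerivAt_evenPotential_ofReal (hF : ∀ z ∈ upperHalfPlaneSet, HasDerivAt F (R z) z)
    (hR : AnalyticAt ℂ R x) : HasDerivAt (fun t : ℝ => evenPotential F t) (R x).re x := by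
  obtain ⟨P, hP, hFP⟩ := exists_primitive_eventuallyEq isOpen_upperHalfPlaneSet
    (convex_halfSpace_im_gt 0) hF hR
  have hfold : ∀ t : ℝ, fold t = t := fun t => fold_of_im_nonneg (Complex.ofReal_im t).ge
  have heq := evenPotential_eventuallyEq (F := F) (z := x)
    (by rw [hfold]; exact analyticAt_of_eventually_hasDerivAt hP) (by rwa [hfold])
  refine hP.self_of_nhds.real_of_complex.congr_of_eventuallyEq ?_
  filter_upwards [Complex.continuous_ofReal.continuousAt.eventually heq] with t ht
  rw [ht, hfold]

theorem evenPotential_sub_log_isBigO (hc : Continuous (evenPotential F))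
    (hF : DifferentiableOn ℂ F upperHalfPlaneSet)
    (hlog : (fun z => (F z).re - Real.log ‖z‖) =O[cobounded ℂ ⊓ 𝓟 upperHalfPlaneSet]
      (fun _ => (1 : ℝ))) :
    (fun z => evenPotential F z - Real.log ‖z‖) =O[cobounded ℂ] (fun _ => (1 : ℝ)) := by
  obtain ⟨C, hC⟩ := Asymptotics.isBigO_iff.1 hlog
  obtain ⟨ρ, -, hρ⟩ := hasBasis_cobounded_norm.eventually_iff.1
    (eventually_inf_principal.1 hC)
  refine Asymptotics.isBigO_iff.2 ⟨C, ?_⟩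
  filter_upwards [tendsto_norm_cobounded_atTop.eventually (eventually_gt_atTop (max ρ 0))]
    with z hz
  have hz0 : ‖fold z‖ ≠ 0 := by
    rw [norm_fold]
    exact ((le_max_right ρ 0).trans_lt hz).ne'
  have hlim : Tendsto (fun w => ‖evenPotential F w - Real.log ‖w‖‖)
      (𝓝[upperHalfPlaneSet] (fold z)) (𝓝 ‖evenPotential F (fold z) - Real.log ‖fold z‖‖) :=
    ((hc.tendsto _).sub ((continuous_norm.tendsto _).log hz0)).norm.mono_left nhdsWithin_le_nhds
  have := mem_closure_iff_nhdsWithin_neBot.1 (fold_mem_closure_upperHalfPlaneSet z)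
  have hρz : ∀ᶠ w in 𝓝 (fold z), ρ < ‖w‖ :=
    continuous_norm.continuousAt.eventually_const_lt
      ((le_max_left ρ 0).trans_lt (hz.trans_eq (norm_fold z).symm))
  have hle := le_of_tendsto hlim (b := C * ‖(1 : ℝ)‖) <| by
    filter_upwards [self_mem_nhdsWithin, hρz.filter_mono nhdsWithin_le_nhds] with w hw hwρ
    rw [evenPotential_of_im_pos hF hw]
    exact hρ hwρ.le hw
  have hff : fold (fold z) = fold z := fold_of_im_nonneg (abs_nonneg z.im)
  rwa [norm_fold, evenPotential, hff, ← evenPotential] at hle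

end EvenPotential

/-! ### Differentials with prescribed branch points -/

/-- The differential `p(z) dz / ∏ √(z - e)` with branch points in `s`. When `p` has one zero in
each gap of the set whose end points form `s`, it is the differential of the complexified Green
function. -/
noncomputable def branchDifferential (s : Finset ℝ) (p : ℝ[X]) (z : ℂ) : ℂ :=
  aeval z p / ∏ e ∈ s, upperSqrt (z - e)

section BranchDifferential

variable {s : Finset ℝ} {p : ℝ[X]} {x : ℝ} {z : ℂ}

theorem differentiableAt_branchDifferential (hz : 0 < z.im ∨ z.re ∉ s) :
    DifferentiableAt ℂ (branchDifferential s p) z := by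
  have hze : ∀ e ∈ s, 0 < (z - e).im ∨ (z - e).re ≠ 0 := fun e he => by
    simpa [sub_ne_zero] using hz.imp id fun h => (ne_of_mem_of_not_mem he h).symm
  refine p.differentiable_aeval.differentiableAt.div ?_ ?_
  · exact DifferentiableAt.fun_finsetProd fun e he =>
      ((hasDerivAt_upperSqrt (hze e he)).comp_sub_const z e).differentiableAt
  · refine Finset.prod_ne_zero_iff.2 fun e he h => ?_
    have := hze e he
    simp [upperSqrt_eq_zero_iff.1 h] at this

theorem differentiableOn_branchDifferential :
    DifferentiableOn ℂ (branchDifferential s p) upperHalfPlaneSet := fun _ hz =>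
  (differentiableAt_branchDifferential (Or.inl hz)).differentiableWithinAt

theorem analyticAt_branchDifferential (hx : x ∉ s) : AnalyticAt ℂ (branchDifferential s p) x := by
  rw [Complex.analyticAt_iff_eventually_differentiableAt]
  have hs : IsOpen (s : Set ℝ)ᶜ := s.finite_toSet.isClosed.isOpen_compl
  filter_upwards [(hs.preimage Complex.continuous_re).mem_nhds hx] with z hz
  exact differentiableAt_branchDifferential (Or.inr hz)

theorem branchDifferential_eq_erase_div {e : ℝ} (he : e ∈ s) :
    branchDifferential s p z = branchDifferential (s.erase e) p z / upperSqrt (z - e) := by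
  rw [branchDifferential, branchDifferential, div_div, Finset.prod_erase_mul _ _ he]

theorem prod_upperSqrt_sub {n : ℕ} (hs : s.card = 2 * n) (hz : 0 < z.im) :
    ∏ e ∈ s, upperSqrt (z - e) = z ^ n * ∏ e ∈ s, (1 - e * z⁻¹) ^ (2⁻¹ : ℂ) := by
  rw [Finset.prod_congr rfl fun e _ => upperSqrt_sub_ofReal hz e, Finset.prod_mul_distrib,
    Finset.prod_const, hs, pow_mul, upperSqrt_sq]
  simp only [div_eq_mul_inv]

theorem exists_branchDifferential_eq_div (hp : p.Monic) (hs : s.card = 2 * (p.natDegree + 1)) :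
    ∃ A : ℂ → ℂ, AnalyticAt ℂ A 0 ∧ A 0 = 1 ∧
      ∀ z ∈ upperHalfPlaneSet, branchDifferential s p z = A z⁻¹ / z := by
  refine ⟨fun u => aeval u p.reverse / ∏ e ∈ s, (1 - e * u) ^ (2⁻¹ : ℂ), ?_, ?_, ?_⟩
  · refine (p.reverse.differentiable_aeval.analyticAt 0).div
      (Finset.analyticAt_fun_prod _ fun e _ => ?_) (by simp)
    exact AnalyticAt.cpow (by fun_prop) analyticAt_const (by simp)
  · simp [← coeff_zero_eq_aeval_zero', coeff_zero_reverse, hp.leadingCoeff]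
  · intro z hz
    have hz0 : z ≠ 0 := fun h => by simp [h] at hz
    let := invertibleOfNonzero hz0
    have hrev : aeval z p = aeval z⁻¹ p.reverse * z ^ p.natDegree := by
      simpa only [aeval_def, invOf_eq_inv] using (eval₂_reverse_mul_pow _ z p).symm
    rw [branchDifferential, prod_upperSqrt_sub hs hz, hrev, pow_succ]
    field_simp

theorem continuous_evenPotential_of_branchDifferential {F : ℂ → ℂ}
    (hF : ∀ z ∈ upperHalfPlaneSet, HasDerivAt F (branchDifferential s p z) z) :
    Continuous (evenPotential F) := by
  refine continuous_evenPotential fun z hz => ?_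
  rw [Complex.closure_setOfPred_lt_im] at hz
  rcases (show 0 ≤ z.im from hz).lt_or_eq with him | him
  · exact ⟨F z, (hF z him).continuousAt.tendsto.mono_left nhdsWithin_le_nhds⟩
  obtain ⟨x, rfl⟩ : ∃ x : ℝ, (x : ℂ) = z := ⟨z.re, Complex.ext rfl him⟩
  by_cases hx : x ∈ s
  · exact exists_tendsto_of_div_upperSqrt hF
      (analyticAt_branchDifferential (Finset.notMem_erase x s))
      fun z _ => branchDifferential_eq_erase_div hx
  · obtain ⟨P, hP, hFP⟩ := exists_primitive_eventuallyEq isOpen_upperHalfPlaneSet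
      (convex_halfSpace_im_gt 0) hF (analyticAt_branchDifferential hx)
    exact ⟨P x, (hP.self_of_nhds.continuousAt.tendsto.mono_left nhdsWithin_le_nhds).congr'
      hFP.symm⟩

theorem exists_isGreenFunction_of_branchDifferential {E : Set ℝ} (hE : IsClosed E)
    (hsE : (s : Set ℝ) ⊆ E) (hp : p.Monic) (hs : s.card = 2 * (p.natDegree + 1))
    (hreal : ∀ x ∉ E, (branchDifferential s p (x : ℂ)).im = 0)
    (hconst : ∀ f : ℝ → ℝ, Continuous f →
      (∀ x ∉ s, HasDerivAt f (branchDifferential s p (x : ℂ)).re x) → ∃ k, ∀ x ∈ E, f x = k) :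
    ∃ g : ℂ → ℝ, IsGreenFunction ((fun t : ℝ => (t : ℂ)) '' E) g ∧
      ∀ x ∉ s, HasDerivAt (fun t : ℝ => g t) (branchDifferential s p (x : ℂ)).re x := by
  obtain ⟨F, hF⟩ := exists_primitive_upperHalfPlane (differentiableOn_branchDifferential (p := p))
  have hFd : DifferentiableOn ℂ F upperHalfPlaneSet := fun z hz =>
    (hF z hz).differentiableAt.differentiableWithinAt
  have hcont := continuous_evenPotential_of_branchDifferential hF
  have hderiv : ∀ x ∉ s, HasDerivAt (fun t : ℝ => evenPotential F t)
      (branchDifferential s p (x : ℂ)).re x := fun x hx =>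
    hasDerivAt_evenPotential_ofReal hF (analyticAt_branchDifferential hx)
  obtain ⟨A, hA, hA0, hR⟩ := exists_branchDifferential_eq_div hp hs
  obtain ⟨k, hk⟩ := hconst _ (hcont.comp Complex.continuous_ofReal) hderiv
  refine ⟨fun z => evenPotential F z - k, ⟨fun z hz => ?_, hcont.sub continuous_const, ?_, ?_⟩,
    fun x hx => (hderiv x hx).sub_const k⟩
  · refine HarmonicAt.sub ?_ (harmonicAt_const k)
    by_cases him : z.im = 0
    · obtain ⟨x, rfl⟩ : ∃ x : ℝ, (x : ℂ) = z := ⟨z.re, Complex.ext rfl him.symm⟩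
      have hxE : x ∉ E := fun h => hz ⟨x, h, rfl⟩
      exact harmonicAt_evenPotential_ofReal hF
        (analyticAt_branchDifferential fun h => hxE (hsE h))
        (mem_of_superset (hE.isOpen_compl.mem_nhds hxE) hreal)
    · exact harmonicAt_evenPotential_of_im_ne_zero hFd him
  · rintro _ ⟨x, hx, rfl⟩
    exact sub_eq_zero.2 (hk x hx)
  · refine ((evenPotential_sub_log_isBigO hcont hFd (isBigO_re_sub_log hF hA hA0 hR)).sub
      (Asymptotics.isBigO_const_const k one_ne_zero _)).congr_left fun z => by ring

theorem prod_upperSqrt_ofReal_sub (s : Finset ℝ) (x : ℝ) :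
    ∏ e ∈ s, upperSqrt ((x : ℂ) - e)
      = Complex.I ^ {e ∈ s | x < e}.card * (∏ e ∈ s, √|x - e| : ℝ) := by
  have hfactor : ∀ e : ℝ, upperSqrt ((x : ℂ) - e)
      = (if x < e then Complex.I else 1) * (√|x - e| : ℝ) := fun e => by
    rw [← Complex.ofReal_sub]
    split_ifs with h
    · rw [upperSqrt_ofReal_of_nonpos (sub_neg.2 h).le, abs_of_neg (sub_neg.2 h)]
    · rw [upperSqrt_ofReal_of_nonneg (sub_nonneg.2 (not_lt.1 h)),
        abs_of_nonneg (sub_nonneg.2 (not_lt.1 h)), one_mul]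
  rw [Finset.prod_congr rfl fun e _ => hfactor e, Finset.prod_mul_distrib, Complex.ofReal_prod,
    Finset.prod_ite, Finset.prod_const, Finset.prod_const_one, mul_one]

theorem branchDifferential_ofReal (s : Finset ℝ) (p : ℝ[X]) (x : ℝ) :
    branchDifferential s p x
      = (p.eval x / ∏ e ∈ s, √|x - e| : ℝ) / Complex.I ^ {e ∈ s | x < e}.card := by
  have heval : aeval (x : ℂ) p = (p.eval x : ℝ) := (Polynomial.ofReal_eval p x).symm
  rw [branchDifferential, prod_upperSqrt_ofReal_sub, heval, mul_comm, ← div_div,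
    Complex.ofReal_div]

theorem branchDifferential_ofReal_of_card {m : ℕ} (hm : {e ∈ s | x < e}.card = 2 * m) :
    branchDifferential s p x = ((-1) ^ m * (p.eval x / ∏ e ∈ s, √|x - e|) : ℝ) := by
  rw [branchDifferential_ofReal, hm, pow_mul, Complex.I_sq, div_eq_mul_inv, ← inv_pow,
    inv_neg_one, mul_comm]
  push_cast
  rfl

theorem re_branchDifferential_ofReal_of_odd (hodd : Odd {e ∈ s | x < e}.card) :
    (branchDifferential s p x).re = 0 := by
  obtain ⟨m, hm⟩ := hodd
  rw [branchDifferential_ofReal, hm, pow_succ, pow_mul, Complex.I_sq, ← div_div, Complex.div_I,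
    ← Complex.ofReal_one, ← Complex.ofReal_neg, ← Complex.ofReal_pow, ← Complex.ofReal_div]
  simp only [Complex.neg_re, Complex.mul_I_re, neg_neg, Complex.ofReal_im]

end BranchDifferential

/-! ### One interval -/

theorem constant_on_Icc_of_hasDerivAt_zero {f : ℝ → ℝ} {a b : ℝ} (hf : ContinuousOn f (Icc a b))
    (hd : ∀ x ∈ Ioo a b, HasDerivAt f 0 x) : ∀ x ∈ Icc a b, f x = f a := by
  rintro x ⟨hax, hxb⟩
  rcases hax.eq_or_lt with rfl | hax
  · rfl
  obtain ⟨y, -, hfy⟩ := exists_hasDerivAt_eq_slope f (fun _ => 0) hax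
    (hf.mono (Icc_subset_Icc_right hxb)) fun y hy => hd y ⟨hy.1, hy.2.trans_le hxb⟩
  rw [eq_comm, div_eq_zero_iff, sub_eq_zero, sub_eq_zero] at hfy
  exact hfy.resolve_right hax.ne'

theorem exists_isGreenFunction_Icc {a b : ℝ} (hab : a < b) :
    ∃ g : ℂ → ℝ, IsGreenFunction ((fun t : ℝ => (t : ℂ)) '' Icc a b) g ∧
      ∀ x < a, HasDerivAt (fun t : ℝ => g t) (-(√(a - x) * √(b - x))⁻¹) x := by
  have hcard : ∀ {x : ℝ}, x < a → {e ∈ ({a, b} : Finset ℝ) | x < e}.card = 2 * 1 := fun hx => by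
    rw [Finset.filter_true_of_mem (by simp [hx, hx.trans hab]), Finset.card_pair hab.ne]
  have hreal : ∀ x ∉ Icc a b, (branchDifferential {a, b} 1 (x : ℂ)).im = 0 := fun x hx => by
    rcases lt_or_ge x a with hxa | hxa
    · rw [branchDifferential_ofReal_of_card (hcard hxa), Complex.ofReal_im]
    · have hbx : b < x := not_le.1 fun h => hx ⟨hxa, h⟩
      rw [branchDifferential_ofReal_of_card (m := 0), Complex.ofReal_im]
      simp [Finset.filter_insert, Finset.filter_singleton, hxa.not_gt, hbx.not_gt]
  obtain ⟨g, hg, hd⟩ := exists_isGreenFunction_of_branchDifferential isClosed_Icc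
    (by simp [insert_subset_iff, hab.le]) monic_one (by simp [Finset.card_pair hab.ne]) hreal
    fun f hf hfd => ⟨f a, constant_on_Icc_of_hasDerivAt_zero hf.continuousOn fun x hx => by
      have hodd : Odd {e ∈ ({a, b} : Finset ℝ) | x < e}.card := by
        simp [Finset.filter_insert, Finset.filter_singleton, hx.1.not_gt, hx.2]
      have hxs : x ∉ ({a, b} : Finset ℝ) := by simp [hx.1.ne', hx.2.ne]
      exact (hfd x hxs).congr_deriv (re_branchDifferential_ofReal_of_odd hodd)⟩
  refine ⟨g, hg, fun x hx => (hd x (by simp [hx.ne, (hx.trans hab).ne])).congr_deriv ?_⟩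
  rw [branchDifferential_ofReal_of_card (hcard hx), Complex.ofReal_re,
    Finset.prod_pair hab.ne, abs_sub_comm x a, abs_sub_comm x b, abs_of_pos (sub_pos.2 hx),
    abs_of_pos (sub_pos.2 (hx.trans hab))]
  simp

theorem hasDerivAt_arcosh_sub_div {δ y : ℝ} (hδ : δ < 1) (hy : y < -1 + 2 * δ) :
    HasDerivAt (fun y => Real.arcosh ((δ - y) / (1 - δ)))
      (-(√(-1 + 2 * δ - y) * √(1 - y))⁻¹) y := by
  have hδ' : 0 < 1 - δ := sub_pos.2 hδ
  have hgt : 1 < (δ - y) / (1 - δ) := by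
    rw [one_lt_div hδ']
    linarith
  have hlin : HasDerivAt (fun y => (δ - y) / (1 - δ)) (-1 / (1 - δ)) y :=
    ((hasDerivAt_id y).const_sub δ).div_const _
  refine ((Real.hasDerivAt_arcosh hgt).comp y hlin).congr_deriv ?_
  have hsq : ((δ - y) / (1 - δ)) ^ 2 - 1 = (-1 + 2 * δ - y) * (1 - y) / (1 - δ) ^ 2 := by
    field_simp
    ring
  rw [hsq, Real.sqrt_div' _ (sq_nonneg _), Real.sqrt_sq hδ'.le, Real.sqrt_mul (by linarith)]
  field_simp

theorem greenOne_eq_arcosh {δ x : ℝ} (hδ : δ < 1) (hx : x ≤ 1) :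
    greenOne δ x = Real.arcosh (max 1 ((δ - x) / (1 - δ))) := by
  have hδ' : 0 < 1 - δ := sub_pos.2 hδ
  obtain ⟨g, hg, hd⟩ := exists_isGreenFunction_Icc (show -1 + 2 * δ < 1 by linarith)
  rw [greenOne, hg.greenFunction_eq]
  have hg0 : ∀ y ∈ Icc (-1 + 2 * δ) 1, g y = 0 := fun y hy => hg.zero_on _ ⟨y, hy, rfl⟩
  rcases le_total (-1 + 2 * δ) x with hxδ | hxδ
  · rw [hg0 x ⟨hxδ, hx⟩, max_eq_left, Real.arcosh_zero]
    rw [div_le_one hδ']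
    linarith
  have h1 : ∀ y, y ≤ -1 + 2 * δ → 1 ≤ (δ - y) / (1 - δ) := fun y hy => by
    rw [one_le_div hδ']
    linarith
  rw [max_eq_right (h1 x hxδ)]
  have hconst := constant_on_Icc_of_hasDerivAt_zero (a := x) (b := -1 + 2 * δ)
    (f := fun y => g y - Real.arcosh ((δ - y) / (1 - δ))) ?_ ?_ (-1 + 2 * δ) ⟨hxδ, le_rfl⟩
  · have hend : (δ - (-1 + 2 * δ)) / (1 - δ) = 1 := by
      rw [div_eq_one_iff_eq hδ'.ne']
      ring
    rw [hend, Real.arcosh_zero, hg0 _ ⟨le_rfl, by linarith⟩] at hconst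
    linarith
  · refine hg.continuous.comp_continuousOn (by fun_prop) |>.sub ?_
    exact Real.continuousOn_arcosh.comp (by fun_prop) fun y hy => h1 y hy.2
  · intro y hy
    exact ((hd y hy.2).sub (hasDerivAt_arcosh_sub_div hδ hy.2)).congr_deriv (sub_self _)

/-! ### Two intervals -/

/-- The open interval `(α - δ, α + δ)` is a proper gap in `[-1, 1]`. -/
structure IsGap (δ α : ℝ) : Prop where
  pos : 0 < δ
  neg_one_lt : -1 < α - δ
  lt_one : α + δ < 1

namespace IsGap

variable {δ α : ℝ}

theorem sub_lt_add (h : IsGap δ α) : α - δ < α + δ := by linarith [h.pos]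

theorem of_mem_Ioc (hδ : 0 < δ) (hδ1 : δ < 1) (hα : α ∈ Ioc (δ - 1) 0) : IsGap δ α :=
  ⟨hδ, by linarith [hα.1], by linarith [hα.2]⟩

theorem zero (hδ : 0 < δ) (hδ1 : δ < 1) : IsGap δ 0 := ⟨hδ, by linarith, by linarith⟩

theorem eventually (h : IsGap δ α) : ∀ᶠ β in 𝓝 α, IsGap δ β := by
  filter_upwards [lt_mem_nhds (lt_sub_iff_add_lt.1 h.neg_one_lt),
    gt_mem_nhds (lt_sub_iff_add_lt.2 h.lt_one)] with β h₁ h₂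
  exact ⟨h.pos, lt_sub_iff_add_lt.2 h₁, lt_sub_iff_add_lt.1 h₂⟩

theorem Icc_subset (h : IsGap δ α) : Icc (α - δ) (α + δ) ⊆ Ioo (-1) 1 :=
  Icc_subset_Ioo h.neg_one_lt h.lt_one

theorem add_mul_cos_mem_Icc (h : IsGap δ α) (θ : ℝ) :
    α + δ * Real.cos θ ∈ Icc (α - δ) (α + δ) := by
  have hlow := mul_le_mul_of_nonneg_left (Real.neg_one_le_cos θ) h.pos.le
  have hhigh := mul_le_mul_of_nonneg_left (Real.cos_le_one θ) h.pos.le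
  constructor <;> linarith

theorem add_mul_cos_mem_Ioo (h : IsGap δ α) (θ : ℝ) : α + δ * Real.cos θ ∈ Ioo (-1) 1 :=
  h.Icc_subset (h.add_mul_cos_mem_Icc θ)

theorem add_mul_cos_mem_gap (h : IsGap δ α) {θ : ℝ} (hθ : θ ∈ Ioo 0 Real.pi) :
    α + δ * Real.cos θ ∈ Ioo (α - δ) (α + δ) := by
  have hδ := h.pos
  have hhigh : Real.cos θ < 1 := by
    simpa using Real.cos_lt_cos_of_nonneg_of_le_pi le_rfl hθ.2.le hθ.1
  have hlow : -1 < Real.cos θ := by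
    simpa using Real.cos_lt_cos_of_nonneg_of_le_pi hθ.1.le le_rfl hθ.2
  constructor <;> nlinarith

theorem twoIntervals_eq (h : IsGap δ α) :
    twoIntervals α δ = Icc (-1) (α - δ) ∪ Icc (α + δ) 1 := by
  obtain ⟨hδ, h₁, h₂⟩ := h
  ext x
  simp only [twoIntervals, Set.mem_sdiff, mem_Icc, mem_Ioo, mem_union]
  grind

end IsGap

/-- The density `1 / √(1 - t²)` of the arcsine distribution on `(-1, 1)`, up to the factor `π`. -/
noncomputable def arcWeight (t : ℝ) : ℝ := (√(1 - t ^ 2))⁻¹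

/-- The integral of `v` over the part of the gap below `α + δ cos φ`, with respect to
`dt / √(δ² - (t - α)²)`, written in the angular variable of `t = α + δ cos θ`. -/
noncomputable def arcIntegral (v : ℝ → ℝ) (δ α φ : ℝ) : ℝ :=
  ∫ θ in φ..Real.pi, v (α + δ * Real.cos θ)

/-- The critical point of the Green function in the gap. -/
noncomputable def gapCenter (δ α : ℝ) : ℝ :=
  arcIntegral (fun t => t * arcWeight t) δ α 0 / arcIntegral arcWeight δ α 0

/-- The Green function in the gap, at the point `α + δ cos φ`. -/
noncomputable def gapGreen (δ α φ : ℝ) : ℝ :=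
  gapCenter δ α * arcIntegral arcWeight δ α φ - arcIntegral (fun t => t * arcWeight t) δ α φ

/-- The end points of the two intervals `[-1, 1] \ (α - δ, α + δ)`. -/
noncomputable def endPoints (δ α : ℝ) : Finset ℝ := {-1, α - δ, α + δ, 1}

section TwoIntervals

variable {δ α x φ : ℝ} {f v : ℝ → ℝ}

theorem one_sub_sq_pos {t : ℝ} (ht : t ∈ Ioo (-1 : ℝ) 1) : 0 < 1 - t ^ 2 := by
  nlinarith [ht.1, ht.2]

theorem arcWeight_pos {t : ℝ} (ht : t ∈ Ioo (-1 : ℝ) 1) : 0 < arcWeight t :=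
  inv_pos.2 (Real.sqrt_pos.2 (one_sub_sq_pos ht))

theorem continuousOn_arcWeight : ContinuousOn arcWeight (Ioo (-1) 1) :=
  ContinuousOn.inv₀ (by fun_prop) fun _ ht => (Real.sqrt_pos.2 (one_sub_sq_pos ht)).ne'

theorem continuousOn_id_mul_arcWeight : ContinuousOn (fun t => t * arcWeight t) (Ioo (-1) 1) :=
  continuousOn_id.mul continuousOn_arcWeight

theorem continuous_comp_arc (hv : ContinuousOn v (Ioo (-1) 1)) (h : IsGap δ α) :
    Continuous fun θ => v (α + δ * Real.cos θ) :=
  hv.comp_continuous (by fun_prop) h.add_mul_cos_mem_Ioo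

theorem arcIntegral_pos (hv : ContinuousOn v (Ioo (-1) 1)) (h : IsGap δ α)
    (hpos : ∀ t ∈ Ioo (α - δ) (α + δ), 0 < v t) (hφ : φ ∈ Ico 0 Real.pi) :
    0 < arcIntegral v δ α φ :=
  intervalIntegral.intervalIntegral_pos_of_pos_on
    ((continuous_comp_arc hv h).intervalIntegrable _ _)
    (fun _ hθ => hpos _ (h.add_mul_cos_mem_gap ⟨hφ.1.trans_lt hθ.1, hθ.2⟩)) hφ.2

theorem arcIntegral_arcWeight_pos (h : IsGap δ α) (hφ : φ ∈ Ico 0 Real.pi) :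
    0 < arcIntegral arcWeight δ α φ :=
  arcIntegral_pos continuousOn_arcWeight h
    (fun _ ht => arcWeight_pos (h.Icc_subset (Ioo_subset_Icc_self ht))) hφ

theorem gapCenter_mul (h : IsGap δ α) : gapCenter δ α * arcIntegral arcWeight δ α 0
    = arcIntegral (fun t => t * arcWeight t) δ α 0 :=
  div_mul_cancel₀ _ (arcIntegral_arcWeight_pos h ⟨le_rfl, Real.pi_pos⟩).ne'

theorem gapGreen_zero (h : IsGap δ α) : gapGreen δ α 0 = 0 := by
  rw [gapGreen, gapCenter_mul h, sub_self]

theorem gapGreen_pi (δ α : ℝ) : gapGreen δ α Real.pi = 0 := by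
  simp [gapGreen, arcIntegral]

theorem gapGreen_eq_integral (h : IsGap δ α) (φ : ℝ) :
    gapGreen δ α φ = ∫ θ in φ..Real.pi,
      (gapCenter δ α - (α + δ * Real.cos θ)) * arcWeight (α + δ * Real.cos θ) := by
  rw [gapGreen, arcIntegral, arcIntegral, ← intervalIntegral.integral_const_mul,
    ← intervalIntegral.integral_sub]
  · simp only [sub_mul]
  · exact ((continuous_comp_arc continuousOn_arcWeight h).intervalIntegrable _ _).const_mul _
  · exact (continuous_comp_arc continuousOn_id_mul_arcWeight h).intervalIntegrable _ _

theorem nodup_endPoints (h : IsGap δ α) :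
    -1 ∉ ({α - δ, α + δ, 1} : Finset ℝ) ∧ α - δ ∉ ({α + δ, 1} : Finset ℝ) := by
  obtain ⟨hδ, h₁, h₂⟩ := h
  simp only [Finset.mem_insert, Finset.mem_singleton]
  grind

theorem card_endPoints (h : IsGap δ α) : (endPoints δ α).card = 4 := by
  obtain ⟨h₁, h₂⟩ := nodup_endPoints h
  rw [endPoints, Finset.card_insert_of_notMem h₁, Finset.card_insert_of_notMem h₂,
    Finset.card_pair h.lt_one.ne]

theorem prod_endPoints (h : IsGap δ α) (x : ℝ) :
    ∏ e ∈ endPoints δ α, √|x - e| = √|1 - x ^ 2| * √|δ ^ 2 - (x - α) ^ 2| := by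
  obtain ⟨h₁, h₂⟩ := nodup_endPoints h
  rw [endPoints, Finset.prod_insert h₁, Finset.prod_insert h₂, Finset.prod_pair h.lt_one.ne]
  simp only [← Real.sqrt_mul (abs_nonneg _), ← abs_mul, ← abs_neg (δ ^ 2 - _)]
  rw [← abs_neg]
  congr 2
  ring

theorem card_filter_endPoints_of_mem_gap (h : IsGap δ α) (hx : x ∈ Ioo (α - δ) (α + δ)) :
    {e ∈ endPoints δ α | x < e}.card = 2 * 1 := by
  obtain ⟨-, h₁, h₂⟩ := h
  have h1 : ¬ x < -1 := by linarith [hx.1]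
  have h4 : x < 1 := by linarith [hx.2]
  simp [endPoints, Finset.filter_insert, Finset.filter_singleton, hx.1.not_gt, hx.2, h1, h4,
    Finset.card_pair h₂.ne]

theorem im_branchDifferential_endPoints (p : ℝ[X]) (h : IsGap δ α) (hx : x ∉ twoIntervals α δ) :
    (branchDifferential (endPoints δ α) p x).im = 0 := by
  suffices ∃ m, {e ∈ endPoints δ α | x < e}.card = 2 * m by
    obtain ⟨m, hm⟩ := this
    rw [branchDifferential_ofReal_of_card hm, Complex.ofReal_im]
  by_cases hgap : x ∈ Ioo (α - δ) (α + δ)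
  · exact ⟨1, card_filter_endPoints_of_mem_gap h hgap⟩
  have hx' : ¬ (-1 ≤ x ∧ x ≤ 1) := fun hx' => hx ⟨hx', hgap⟩
  obtain ⟨-, h₁, h₂⟩ := id h
  have := h.sub_lt_add
  rcases lt_or_ge x (-1) with hlt | hge
  · refine ⟨2, ?_⟩
    rw [Finset.filter_true_of_mem, card_endPoints h]
    simp only [endPoints, Finset.mem_insert, Finset.mem_singleton]
    grind
  · refine ⟨0, ?_⟩
    rw [mul_zero, Finset.card_eq_zero, Finset.filter_eq_empty_iff]
    simp only [endPoints, Finset.mem_insert, Finset.mem_singleton]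
    grind

theorem re_branchDifferential_endPoints (p : ℝ[X]) (h : IsGap δ α)
    (hx : x ∈ Ioo (-1) (α - δ) ∪ Ioo (α + δ) 1) :
    (branchDifferential (endPoints δ α) p x).re = 0 := by
  obtain ⟨-, h₁, h₂⟩ := id h
  have hlt := h.sub_lt_add
  refine re_branchDifferential_ofReal_of_odd ?_
  rcases hx with hx | hx
  · have h3 : x < α + δ := hx.2.trans hlt
    have hcard : ({α - δ, α + δ, 1} : Finset ℝ).card = 3 := by
      rw [Finset.card_insert_of_notMem (nodup_endPoints h).2, Finset.card_pair h₂.ne]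
    rw [endPoints, Finset.filter_insert, if_neg hx.1.not_gt, Finset.filter_true_of_mem, hcard]
    · decide
    · simp [hx.2, h3, h3.trans h₂]
  · have h2 : ¬ x < α - δ := (hlt.trans hx.1).not_gt
    have h1 : ¬ x < -1 := (h₁.trans (hlt.trans hx.1)).not_gt
    simp [endPoints, Finset.filter_insert, Finset.filter_singleton, h1, h2, hx.1.not_gt, hx.2]

theorem hasDerivAt_comp_arc_of_branchDifferential (h : IsGap δ α) {c θ : ℝ}
    (hθ : θ ∈ Ioo 0 Real.pi)
    (hf : HasDerivAt f (branchDifferential (endPoints δ α) (X - C c)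
      (α + δ * Real.cos θ : ℝ)).re (α + δ * Real.cos θ)) :
    HasDerivAt (fun θ => -f (α + δ * Real.cos θ))
      ((c - (α + δ * Real.cos θ)) * arcWeight (α + δ * Real.cos θ)) θ := by
  have hδ := h.pos
  have hsin : 0 < Real.sin θ := Real.sin_pos_of_mem_Ioo hθ
  have hw := one_sub_sq_pos (h.add_mul_cos_mem_Ioo θ)
  have hcos : HasDerivAt (fun θ => α + δ * Real.cos θ) (δ * -Real.sin θ) θ :=
    ((Real.hasDerivAt_cos θ).const_mul δ).const_add α
  refine (hf.comp θ hcos).neg.congr_deriv ?_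
  have hsq : δ ^ 2 - (α + δ * Real.cos θ - α) ^ 2 = (δ * Real.sin θ) ^ 2 := by
    linear_combination (-δ ^ 2) * Real.sin_sq_add_cos_sq θ
  rw [branchDifferential_ofReal_of_card
    (card_filter_endPoints_of_mem_gap h (h.add_mul_cos_mem_gap hθ)), Complex.ofReal_re,
    prod_endPoints h, hsq, abs_sq, Real.sqrt_sq (by positivity), abs_of_pos hw, arcWeight]
  simp only [eval_sub, eval_X, eval_C]
  field_simp
  ring

theorem notMem_endPoints (h₁ : x ≠ -1) (h₂ : x ≠ α - δ) (h₃ : x ≠ α + δ) (h₄ : x ≠ 1) :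
    x ∉ endPoints δ α := by
  simp [endPoints, h₁, h₂, h₃, h₄]

theorem notMem_endPoints_of_mem_gap (h : IsGap δ α) (hx : x ∈ Ioo (α - δ) (α + δ)) :
    x ∉ endPoints δ α :=
  notMem_endPoints (h.neg_one_lt.trans hx.1).ne' hx.1.ne' hx.2.ne (hx.2.trans h.lt_one).ne

theorem sub_eq_gapGreen (h : IsGap δ α) (hf : Continuous f)
    (hd : ∀ x ∉ endPoints δ α,
      HasDerivAt f (branchDifferential (endPoints δ α) (X - C (gapCenter δ α)) x).re x)
    (hφ : φ ∈ Icc 0 Real.pi) :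
    f (α + δ * Real.cos φ) - f (α - δ) = gapGreen δ α φ := by
  have hint : Continuous fun θ =>
      (gapCenter δ α - (α + δ * Real.cos θ)) * arcWeight (α + δ * Real.cos θ) :=
    (by fun_prop : Continuous fun θ => gapCenter δ α - (α + δ * Real.cos θ)).mul
      (continuous_comp_arc continuousOn_arcWeight h)
  rw [gapGreen_eq_integral h, intervalIntegral.integral_eq_sub_of_hasDerivAt_of_le hφ.2
    (f := fun θ => -f (α + δ * Real.cos θ)) (by fun_prop) (fun θ hθ => ?_)
    (hint.intervalIntegrable _ _)]
  · rw [Real.cos_pi]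
    ring_nf
  · have hθ' : θ ∈ Ioo 0 Real.pi := ⟨hφ.1.trans_lt hθ.1, hθ.2⟩
    exact hasDerivAt_comp_arc_of_branchDifferential h hθ'
      (hd _ (notMem_endPoints_of_mem_gap h (h.add_mul_cos_mem_gap hθ')))

theorem const_on_twoIntervals (h : IsGap δ α) (hf : Continuous f)
    (hd : ∀ x ∉ endPoints δ α,
      HasDerivAt f (branchDifferential (endPoints δ α) (X - C (gapCenter δ α)) x).re x) :
    ∀ x ∈ twoIntervals α δ, f x = f (-1) := by
  obtain ⟨-, h₁, h₂⟩ := id h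
  have hleft : ∀ x ∈ Icc (-1) (α - δ), f x = f (-1) :=
    constant_on_Icc_of_hasDerivAt_zero hf.continuousOn fun y hy =>
      (hd y (notMem_endPoints hy.1.ne' hy.2.ne (hy.2.trans h.sub_lt_add).ne
        (hy.2.trans (h.sub_lt_add.trans h₂)).ne)).congr_deriv
        (re_branchDifferential_endPoints _ h (Or.inl hy))
  have hright : ∀ x ∈ Icc (α + δ) 1, f x = f (α + δ) :=
    constant_on_Icc_of_hasDerivAt_zero hf.continuousOn fun y hy =>
      (hd y (notMem_endPoints ((h₁.trans h.sub_lt_add).trans hy.1).ne'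
        (h.sub_lt_add.trans hy.1).ne' hy.1.ne' hy.2.ne)).congr_deriv
        (re_branchDifferential_endPoints _ h (Or.inr hy))
  have hgap := sub_eq_gapGreen h hf hd ⟨le_rfl, Real.pi_pos.le⟩
  rw [gapGreen_zero h, Real.cos_zero, mul_one, sub_eq_zero] at hgap
  rw [h.twoIntervals_eq]
  rintro x (hx | hx)
  · exact hleft x hx
  · rw [hright x hx, hgap, hleft _ ⟨h₁.le, le_rfl⟩]

theorem exists_isGreenFunction_twoIntervals (h : IsGap δ α) :
    ∃ g : ℂ → ℝ, IsGreenFunction ((fun t : ℝ => (t : ℂ)) '' twoIntervals α δ) g ∧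
      ∀ φ ∈ Icc 0 Real.pi, g ((α + δ * Real.cos φ : ℝ) : ℂ) = gapGreen δ α φ := by
  have hclosed : IsClosed (twoIntervals α δ) :=
    h.twoIntervals_eq ▸ isClosed_Icc.union isClosed_Icc
  have hsub : (endPoints δ α : Set ℝ) ⊆ twoIntervals α δ := by
    simp [endPoints, h.twoIntervals_eq, insert_subset_iff, h.neg_one_lt.le, h.lt_one.le]
  obtain ⟨g, hg, hd⟩ := exists_isGreenFunction_of_branchDifferential hclosed hsub
    (monic_X_sub_C (gapCenter δ α)) (by rw [card_endPoints h, natDegree_X_sub_C])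
    (fun x => im_branchDifferential_endPoints _ h)
    fun f hf hd => ⟨f (-1), const_on_twoIntervals h hf hd⟩
  refine ⟨g, hg, fun φ hφ => ?_⟩
  rw [← sub_eq_gapGreen h (hg.continuous.comp Complex.continuous_ofReal) hd hφ]
  have hend : g (α - δ : ℝ) = 0 := hg.zero_on _ ⟨_, hsub (by simp [endPoints]), rfl⟩
  simp only [Function.comp_apply, hend, sub_zero]

theorem greenTwo_eq_gapGreen (h : IsGap δ α) (hx : x ∈ Icc (-1 : ℝ) 1) :
    greenTwo α δ x = gapGreen δ α (Real.arccos ((x - α) / δ)) := by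
  obtain ⟨g, hg, hgap⟩ := exists_isGreenFunction_twoIntervals h
  rw [greenTwo, hg.greenFunction_eq]
  rcases le_or_gt x (α - δ) with hl | hl
  · rw [Real.arccos_of_le_neg_one (by rw [div_le_iff₀ h.pos]; linarith), gapGreen_pi]
    exact hg.zero_on _ ⟨x, ⟨hx, fun hx' => hl.not_gt hx'.1⟩, rfl⟩
  rcases le_or_gt (α + δ) x with hr | hr
  · rw [Real.arccos_of_one_le (by rw [le_div_iff₀ h.pos]; linarith), gapGreen_zero h]
    exact hg.zero_on _ ⟨x, ⟨hx, fun hx' => hr.not_gt hx'.2⟩, rfl⟩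
  · rw [← hgap _ ⟨Real.arccos_nonneg _, Real.arccos_le_pi _⟩, Real.cos_arccos,
      mul_div_cancel₀ _ h.pos.ne', add_sub_cancel]
    · rw [le_div_iff₀ h.pos]
      linarith
    · rw [div_le_iff₀ h.pos]
      linarith

theorem greenTwo_nonneg (h : IsGap δ α) (x : ℝ) : 0 ≤ greenTwo α δ x := by
  obtain ⟨g, hg, -⟩ := exists_isGreenFunction_twoIntervals h
  rw [greenTwo, hg.greenFunction_eq]
  exact hg.nonneg _

theorem greenTwo_eq_zero (h : IsGap δ α) (hx : x ∈ twoIntervals α δ) : greenTwo α δ x = 0 := by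
  obtain ⟨g, hg, -⟩ := exists_isGreenFunction_twoIntervals h
  rw [greenTwo, hg.greenFunction_eq]
  exact hg.zero_on _ ⟨x, hx, rfl⟩

theorem greenTwo_le_greenOne (h : IsGap δ α) (x : ℝ) :
    greenTwo α δ x ≤ greenOne ((1 + α + δ) / 2) x := by
  obtain ⟨g, hg, -⟩ := exists_isGreenFunction_twoIntervals h
  obtain ⟨g', hg', -⟩ := exists_isGreenFunction_Icc h.lt_one
  have hend : -1 + 2 * ((1 + α + δ) / 2) = α + δ := by ring
  rw [greenTwo, greenOne, hg.greenFunction_eq, hend, hg'.greenFunction_eq]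
  exact hg'.le_of_subset hg (image_mono (h.twoIntervals_eq ▸ subset_union_right)) _

end TwoIntervals

/-! ### Integrals over arcs as functions of the centre and the angle -/

section ArcIntegral

variable {δ α : ℝ} {v v' : ℝ → ℝ}

theorem exists_eventually_norm_comp_arc_le (hv : ContinuousOn v (Ioo (-1) 1)) (h : IsGap δ α) :
    ∃ M, ∀ᶠ β in 𝓝 α, ∀ θ, ‖v (β + δ * Real.cos θ)‖ ≤ M := by
  obtain ⟨lo, hlo, hlo'⟩ := exists_between h.neg_one_lt
  obtain ⟨hi, hhi, hhi'⟩ := exists_between h.lt_one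
  obtain ⟨M, hM⟩ := isCompact_Icc.exists_bound_of_continuousOn (hv.mono (Icc_subset_Ioo hlo hhi'))
  refine ⟨M, ?_⟩
  filter_upwards [h.eventually, lt_mem_nhds (lt_sub_iff_add_lt.1 hlo'),
    gt_mem_nhds (lt_sub_iff_add_lt.2 hhi)] with β hβ hβlo hβhi θ
  exact hM _ (Icc_subset_Icc (lt_sub_iff_add_lt.2 hβlo).le (lt_sub_iff_add_lt.1 hβhi).le
    (hβ.add_mul_cos_mem_Icc θ))

theorem arcIntegral_eq_mul_integral (v : ℝ → ℝ) (δ α φ : ℝ) :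
    arcIntegral v δ α φ = (Real.pi - φ) *
      ∫ s in (0 : ℝ)..1, v (α + δ * Real.cos (φ + (Real.pi - φ) * s)) := by
  rw [arcIntegral, intervalIntegral.mul_integral_comp_add_mul
    (f := fun θ => v (α + δ * Real.cos θ)), mul_zero, mul_one, add_zero, add_sub_cancel]

theorem continuousAt_arcIntegral (hv : ContinuousOn v (Ioo (-1) 1)) (h : IsGap δ α) (φ : ℝ) :
    ContinuousAt (fun p : ℝ × ℝ => arcIntegral v δ p.1 p.2) (α, φ) := by
  obtain ⟨M, hM⟩ := exists_eventually_norm_comp_arc_le hv h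
  simp only [arcIntegral_eq_mul_integral]
  have hfst : Tendsto Prod.fst (𝓝 (α, φ)) (𝓝 α) := continuous_fst.tendsto _
  refine ContinuousAt.mul (by fun_prop) (intervalIntegral.continuousAt_of_dominated_interval
    (bound := fun _ => M) ?_ ?_ intervalIntegrable_const (Eventually.of_forall fun s _ => ?_))
  · filter_upwards [hfst.eventually h.eventually] with p hp
    exact ((continuous_comp_arc hv hp).comp (g := fun θ => v (p.1 + δ * Real.cos θ))
      (by fun_prop)).aestronglyMeasurable
  · exact (hfst.eventually hM).mono fun p hp => Eventually.of_forall fun s _ => hp _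
  · exact ContinuousAt.comp
      (f := fun p : ℝ × ℝ => p.1 + δ * Real.cos (p.2 + (Real.pi - p.2) * s))
      (hv.continuousAt (Ioo_mem_nhds (h.add_mul_cos_mem_Ioo _).1 (h.add_mul_cos_mem_Ioo _).2))
      (by fun_prop)

theorem hasDerivAt_arcIntegral_center (hv : ∀ t ∈ Ioo (-1) 1, HasDerivAt v (v' t) t)
    (hv' : ContinuousOn v' (Ioo (-1) 1)) (h : IsGap δ α) (φ : ℝ) :
    HasDerivAt (fun β => arcIntegral v δ β φ) (arcIntegral v' δ α φ) α := by
  have hvc : ContinuousOn v (Ioo (-1) 1) := fun t ht => (hv t ht).continuousAt.continuousWithinAt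
  obtain ⟨M, hM⟩ := exists_eventually_norm_comp_arc_le hv' h
  exact (intervalIntegral.hasDerivAt_integral_of_dominated_loc_of_deriv_le
    (F := fun β θ => v (β + δ * Real.cos θ)) (F' := fun β θ => v' (β + δ * Real.cos θ))
    (bound := fun _ => M) (hM.and h.eventually)
    (h.eventually.mono fun β hβ => (continuous_comp_arc hvc hβ).aestronglyMeasurable)
    ((continuous_comp_arc hvc h).intervalIntegrable _ _)
    (continuous_comp_arc hv' h).aestronglyMeasurable
    (Eventually.of_forall fun θ _ β hβ => hβ.1 θ) intervalIntegrable_const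
    (Eventually.of_forall fun θ _ β hβ =>
      (hv _ (hβ.2.add_mul_cos_mem_Ioo θ)).comp_add_const β _)).2

theorem hasDerivAt_arcIntegral_angle (hv : ContinuousOn v (Ioo (-1) 1)) (h : IsGap δ α) (φ : ℝ) :
    HasDerivAt (fun ψ => arcIntegral v δ α ψ) (-v (α + δ * Real.cos φ)) φ := by
  have hc := continuous_comp_arc hv h
  exact intervalIntegral.integral_hasDerivAt_left (hc.intervalIntegrable _ _)
    hc.aestronglyMeasurable.stronglyMeasurableAtFilter hc.continuousAt

theorem hasDerivAt_arcIntegral (hv : ∀ t ∈ Ioo (-1) 1, HasDerivAt v (v' t) t)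
    (hv' : ContinuousOn v' (Ioo (-1) 1)) (h : IsGap δ α) {φ : ℝ → ℝ} {φ' : ℝ}
    (hφ : HasDerivAt φ φ' α) :
    HasDerivAt (fun β => arcIntegral v δ β (φ β))
      (arcIntegral v' δ α (φ α) - φ' * v (α + δ * Real.cos (φ α))) α := by
  have hvc : ContinuousOn v (Ioo (-1) 1) := fun t ht => (hv t ht).continuousAt.continuousWithinAt
  have hgap : ∀ᶠ p : ℝ × ℝ in 𝓝 (α, φ α), IsGap δ p.1 :=
    continuous_fst.continuousAt.eventually h.eventually
  have hspan := (ContinuousLinearMap.toSpanSingletonCLE (𝕜 := ℝ) (E := ℝ)).continuous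
  have hvα : ContinuousAt (fun p : ℝ × ℝ => v (p.1 + δ * Real.cos p.2)) (α, φ α) :=
    ContinuousAt.comp (f := fun p : ℝ × ℝ => p.1 + δ * Real.cos p.2)
      (hv _ (h.add_mul_cos_mem_Ioo _)).continuousAt (by fun_prop)
  have hstrict := hasStrictFDerivAt_uncurry_coprod (𝕜 := ℝ) (u := (α, φ α))
    (f := fun β ψ => arcIntegral v δ β ψ)
    (f₁ := fun β ψ => ContinuousLinearMap.toSpanSingleton ℝ (arcIntegral v' δ β ψ))
    (f₂ := fun β ψ => ContinuousLinearMap.toSpanSingleton ℝ (-v (β + δ * Real.cos ψ)))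
    (hgap.mono fun p hp => (hasDerivAt_arcIntegral_center hv hv' hp p.2).hasFDerivAt)
    (hgap.mono fun p hp => (hasDerivAt_arcIntegral_angle hvc hp p.2).hasFDerivAt)
    (hspan.continuousAt.comp (continuousAt_arcIntegral hv' h _))
    (hspan.continuousAt.comp hvα.neg)
  refine (hstrict.hasFDerivAt.comp_hasDerivAt α ((hasDerivAt_id α).prodMk hφ)).congr_deriv ?_
  simp [Function.HasUncurry.uncurry, sub_eq_add_neg]

end ArcIntegral

/-! ### Variation of the Green function with the gap -/

/-- The derivative of `arcWeight`. -/
noncomputable def arcWeightDeriv (t : ℝ) : ℝ := t * arcWeight t ^ 3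

/-- The derivative of `gapCenter` with respect to the centre of the gap. -/
noncomputable def gapCenterDeriv (δ α : ℝ) : ℝ :=
  1 + arcIntegral (fun t => (t - gapCenter δ α) * arcWeightDeriv t) δ α 0 /
    arcIntegral arcWeight δ α 0

/-- The derivative of `(gapCenter δ α - t) * arcWeight t` along a common shift of `α` and `t`. -/
noncomputable def gapDensityDeriv (δ α t : ℝ) : ℝ :=
  (gapCenterDeriv δ α - 1) * arcWeight t - (t - gapCenter δ α) * arcWeightDeriv t

/-- The derivative of the Green function with respect to the centre of the gap, at the point
`α + δ cos φ`. -/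
noncomputable def gapVariation (δ α φ : ℝ) : ℝ :=
  (α + δ * Real.cos φ - gapCenter δ α) * arcWeight (α + δ * Real.cos φ) / (δ * Real.sin φ) +
    arcIntegral (gapDensityDeriv δ α) δ α φ

theorem arcWeight_sq {t : ℝ} (ht : t ∈ Ioo (-1 : ℝ) 1) : arcWeight t ^ 2 = (1 - t ^ 2)⁻¹ := by
  rw [arcWeight, inv_pow, Real.sq_sqrt (one_sub_sq_pos ht).le]

theorem hasDerivAt_arcWeight {t : ℝ} (ht : t ∈ Ioo (-1 : ℝ) 1) :
    HasDerivAt arcWeight (arcWeightDeriv t) t := by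
  have hpos := one_sub_sq_pos ht
  have hsqrt : √(1 - t ^ 2) ≠ 0 := (Real.sqrt_pos.2 hpos).ne'
  have hpoly : HasDerivAt (fun t : ℝ => 1 - t ^ 2) (-(2 * t)) t := by
    simpa using ((hasDerivAt_id t).fun_pow 2).const_sub 1
  refine ((hpoly.sqrt hpos.ne').inv hsqrt).congr_deriv ?_
  rw [arcWeightDeriv, arcWeight]
  field_simp

theorem hasDerivAt_id_mul_arcWeight {t : ℝ} (ht : t ∈ Ioo (-1 : ℝ) 1) :
    HasDerivAt (fun t => t * arcWeight t) (arcWeight t + t * arcWeightDeriv t) t := by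
  simpa using (hasDerivAt_id t).fun_mul (hasDerivAt_arcWeight ht)

theorem continuousOn_arcWeightDeriv : ContinuousOn arcWeightDeriv (Ioo (-1) 1) :=
  continuousOn_id.mul (continuousOn_arcWeight.pow 3)

theorem continuousOn_id_mul_arcWeightDeriv :
    ContinuousOn (fun t => t * arcWeightDeriv t) (Ioo (-1) 1) :=
  continuousOn_id.mul continuousOn_arcWeightDeriv

theorem continuousOn_sub_mul {v : ℝ → ℝ} (hv : ContinuousOn v (Ioo (-1) 1)) (k : ℝ) :
    ContinuousOn (fun t => (t - k) * v t) (Ioo (-1) 1) :=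
  (continuousOn_id.sub continuousOn_const).mul hv

theorem continuousOn_gapDensityDeriv (δ α : ℝ) :
    ContinuousOn (gapDensityDeriv δ α) (Ioo (-1) 1) :=
  (continuousOn_const.fun_mul continuousOn_arcWeight).sub
    (continuousOn_sub_mul continuousOn_arcWeightDeriv _)

theorem mul_arcWeight_le_mul_arcWeightDeriv {c t : ℝ} (hc : c ∈ Ioo (-1 : ℝ) 1)
    (ht : t ∈ Ioo (-1 : ℝ) 1) :
    c / (1 - c ^ 2) * ((t - c) * arcWeight t) ≤ (t - c) * arcWeightDeriv t := by
  have hw := arcWeight_pos ht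
  have ht2 := one_sub_sq_pos ht
  have hc2 := one_sub_sq_pos hc
  have htc : 0 < 1 + t * c := by nlinarith [ht.1, ht.2, hc.1, hc.2]
  have hdiff : (t - c) * arcWeightDeriv t - c / (1 - c ^ 2) * ((t - c) * arcWeight t)
      = (t - c) ^ 2 * (1 + t * c) / ((1 - t ^ 2) * (1 - c ^ 2)) * arcWeight t := by
    rw [arcWeightDeriv, pow_succ, arcWeight_sq ht]
    field_simp
    ring
  rw [← sub_nonneg, hdiff]
  positivity

section Variation

variable {δ α φ : ℝ} {u v : ℝ → ℝ}

theorem arcIntegral_add (hu : ContinuousOn u (Ioo (-1) 1)) (hv : ContinuousOn v (Ioo (-1) 1))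
    (h : IsGap δ α) (φ : ℝ) :
    arcIntegral (fun t => u t + v t) δ α φ = arcIntegral u δ α φ + arcIntegral v δ α φ :=
  intervalIntegral.integral_add ((continuous_comp_arc hu h).intervalIntegrable _ _)
    ((continuous_comp_arc hv h).intervalIntegrable _ _)

theorem arcIntegral_const_mul (v : ℝ → ℝ) (k δ α φ : ℝ) :
    arcIntegral (fun t => k * v t) δ α φ = k * arcIntegral v δ α φ :=
  intervalIntegral.integral_const_mul _ _

theorem arcIntegral_sub_mul (hv : ContinuousOn v (Ioo (-1) 1)) (h : IsGap δ α) (k φ : ℝ) :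
    arcIntegral (fun t => (t - k) * v t) δ α φ
      = arcIntegral (fun t => t * v t) δ α φ - k * arcIntegral v δ α φ := by
  simp only [sub_eq_add_neg, ← neg_mul, add_mul]
  rw [arcIntegral_add (u := fun t => t * v t) (continuousOn_id.mul hv)
    (continuousOn_const.fun_mul hv) h, arcIntegral_const_mul]

theorem arcIntegral_mono (hu : ContinuousOn u (Ioo (-1) 1)) (hv : ContinuousOn v (Ioo (-1) 1))
    (h : IsGap δ α) (huv : ∀ t ∈ Icc (α - δ) (α + δ), u t ≤ v t) (hφ : φ ≤ Real.pi) :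
    arcIntegral u δ α φ ≤ arcIntegral v δ α φ :=
  intervalIntegral.integral_mono hφ ((continuous_comp_arc hu h).intervalIntegrable _ _)
    ((continuous_comp_arc hv h).intervalIntegrable _ _) fun θ => huv _ (h.add_mul_cos_mem_Icc θ)

theorem gapCenter_sub_mul (h : IsGap δ α) (k : ℝ) :
    (gapCenter δ α - k) * arcIntegral arcWeight δ α 0
      = arcIntegral (fun t => (t - k) * arcWeight t) δ α 0 := by
  rw [arcIntegral_sub_mul continuousOn_arcWeight h, ← gapCenter_mul h, sub_mul]

theorem gapCenter_mem (h : IsGap δ α) : gapCenter δ α ∈ Ioo (α - δ) (α + δ) := by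
  have hW := arcIntegral_arcWeight_pos h ⟨le_rfl, Real.pi_pos⟩
  have hw : ∀ t ∈ Ioo (α - δ) (α + δ), 0 < arcWeight t := fun t ht =>
    arcWeight_pos (h.Icc_subset (Ioo_subset_Icc_self ht))
  constructor
  · have hpos := arcIntegral_pos (continuousOn_sub_mul continuousOn_arcWeight (α - δ)) h
      (fun t ht => mul_pos (sub_pos.2 ht.1) (hw t ht)) ⟨le_rfl, Real.pi_pos⟩
    rw [← gapCenter_sub_mul h] at hpos
    exact sub_pos.1 (pos_of_mul_pos_left hpos hW.le)
  · have hpos := arcIntegral_pos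
      (continuousOn_const.fun_mul (continuousOn_sub_mul continuousOn_arcWeight (α + δ))) h
      (fun t ht => mul_pos_of_neg_of_neg neg_one_lt_zero
        (mul_neg_of_neg_of_pos (sub_neg.2 ht.2) (hw t ht))) ⟨le_rfl, Real.pi_pos⟩
    rw [arcIntegral_const_mul, ← gapCenter_sub_mul h, ← mul_assoc] at hpos
    linarith [pos_of_mul_pos_left hpos hW.le]

theorem hasDerivAt_gapCenter (h : IsGap δ α) : HasDerivAt (gapCenter δ) (gapCenterDeriv δ α) α := by
  have hW := arcIntegral_arcWeight_pos h ⟨le_rfl, Real.pi_pos⟩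
  have hN' := hasDerivAt_arcIntegral_center (fun t ht => hasDerivAt_id_mul_arcWeight ht)
    (continuousOn_arcWeight.add continuousOn_id_mul_arcWeightDeriv) h 0
  have hW' := hasDerivAt_arcIntegral_center (fun t ht => hasDerivAt_arcWeight ht)
    continuousOn_arcWeightDeriv h 0
  refine (hN'.div hW' hW.ne').congr_deriv ?_
  rw [arcIntegral_add continuousOn_arcWeight continuousOn_id_mul_arcWeightDeriv h,
    ← gapCenter_mul h, gapCenterDeriv, arcIntegral_sub_mul continuousOn_arcWeightDeriv h]
  field_simp
  ring

theorem one_le_gapCenterDeriv (h : IsGap δ α) : 1 ≤ gapCenterDeriv δ α := by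
  have hc := h.Icc_subset (Ioo_subset_Icc_self (gapCenter_mem h))
  have hmono := arcIntegral_mono
    (continuousOn_const.fun_mul (continuousOn_sub_mul continuousOn_arcWeight _))
    (continuousOn_sub_mul continuousOn_arcWeightDeriv _) h
    (fun t ht => mul_arcWeight_le_mul_arcWeightDeriv hc (h.Icc_subset ht)) Real.pi_pos.le
  rw [arcIntegral_const_mul, ← gapCenter_sub_mul h, sub_self, zero_mul, mul_zero] at hmono
  exact le_add_of_nonneg_right
    (div_nonneg hmono (arcIntegral_arcWeight_pos h ⟨le_rfl, Real.pi_pos⟩).le)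

theorem arcIntegral_gapDensityDeriv (h : IsGap δ α) (φ : ℝ) :
    arcIntegral (gapDensityDeriv δ α) δ α φ = (gapCenterDeriv δ α - 1) * arcIntegral arcWeight δ α φ
      - arcIntegral (fun t => (t - gapCenter δ α) * arcWeightDeriv t) δ α φ := by
  rw [← arcIntegral_const_mul]
  exact intervalIntegral.integral_sub
    ((continuous_comp_arc (continuousOn_const.fun_mul continuousOn_arcWeight)
      h).intervalIntegrable _ _)
    ((continuous_comp_arc (continuousOn_sub_mul continuousOn_arcWeightDeriv _)
      h).intervalIntegrable _ _)

theorem arcIntegral_gapDensityDeriv_zero (h : IsGap δ α) :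
    arcIntegral (gapDensityDeriv δ α) δ α 0 = 0 := by
  rw [arcIntegral_gapDensityDeriv h, gapCenterDeriv, add_sub_cancel_left,
    div_mul_cancel₀ _ (arcIntegral_arcWeight_pos h ⟨le_rfl, Real.pi_pos⟩).ne', sub_self]

theorem hasDerivAt_gapGreen (h : IsGap δ α) {φ : ℝ → ℝ}
    (hφ : HasDerivAt φ (1 / (δ * Real.sin (φ α))) α) :
    HasDerivAt (fun β => gapGreen δ β (φ β)) (gapVariation δ α (φ α)) α := by
  have hN := hasDerivAt_arcIntegral (fun t ht => hasDerivAt_id_mul_arcWeight ht)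
    (continuousOn_arcWeight.add continuousOn_id_mul_arcWeightDeriv) h hφ
  have hW := hasDerivAt_arcIntegral (fun t ht => hasDerivAt_arcWeight ht)
    continuousOn_arcWeightDeriv h hφ
  refine (((hasDerivAt_gapCenter h).mul hW).sub hN).congr_deriv ?_
  rw [arcIntegral_add continuousOn_arcWeight continuousOn_id_mul_arcWeightDeriv h,
    gapVariation, arcIntegral_gapDensityDeriv h,
    arcIntegral_sub_mul continuousOn_arcWeightDeriv h]
  ring

theorem IsGap.sub_div_mem_Ioo (h : IsGap δ α) {x : ℝ} (hx : x ∈ Ioo (α - δ) (α + δ)) :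
    (x - α) / δ ∈ Ioo (-1 : ℝ) 1 := by
  rw [mem_Ioo, lt_div_iff₀ h.pos, div_lt_iff₀ h.pos]
  constructor <;> linarith [hx.1, hx.2]

theorem hasDerivAt_greenTwo (h : IsGap δ α) {x : ℝ} (hx : x ∈ Ioo (α - δ) (α + δ)) :
    HasDerivAt (fun β => greenTwo β δ x) (gapVariation δ α (Real.arccos ((x - α) / δ))) α := by
  obtain ⟨hlow, hhigh⟩ := h.sub_div_mem_Ioo hx
  have hlin : HasDerivAt (fun β => (x - β) / δ) (-1 / δ) α :=
    ((hasDerivAt_id α).const_sub x).div_const δ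
  have hφ : HasDerivAt (fun β => Real.arccos ((x - β) / δ))
      (1 / (δ * Real.sin (Real.arccos ((x - α) / δ)))) α := by
    refine ((Real.hasDerivAt_arccos hlow.ne' hhigh.ne).comp α hlin).congr_deriv ?_
    rw [Real.sin_arccos]
    ring
  refine (hasDerivAt_gapGreen h hφ).congr_of_eventuallyEq ?_
  filter_upwards [h.eventually] with β hβ
  exact greenTwo_eq_gapGreen hβ (Ioo_subset_Icc_self (h.Icc_subset (Ioo_subset_Icc_self hx)))

theorem hasDerivAt_gapVariation (h : IsGap δ α) (hφ : φ ∈ Ioo 0 Real.pi) :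
    HasDerivAt (gapVariation δ α)
      (-(arcWeight (α + δ * Real.cos φ) / (δ * Real.sin φ) ^ 2 *
        (gapCenterDeriv δ α * (δ * Real.sin φ) ^ 2 +
          (α + δ * Real.cos φ - gapCenter δ α) * (δ * Real.cos φ)))) φ := by
  have hδ := h.pos
  have hsin : 0 < Real.sin φ := Real.sin_pos_of_pos_of_lt_pi hφ.1 hφ.2
  have hcos : HasDerivAt (fun φ => α + δ * Real.cos φ) (δ * -Real.sin φ) φ :=
    ((Real.hasDerivAt_cos φ).const_mul δ).const_add α
  have hw := (hasDerivAt_arcWeight (h.add_mul_cos_mem_Ioo φ)).comp φ hcos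
  have hden : HasDerivAt (fun φ => δ * Real.sin φ) (δ * Real.cos φ) φ :=
    (Real.hasDerivAt_sin φ).const_mul δ
  have hquot := ((hcos.sub_const (gapCenter δ α)).mul hw).div hden (by positivity)
  refine (hquot.add (hasDerivAt_arcIntegral_angle (continuousOn_gapDensityDeriv δ α) h
    φ)).congr_deriv ?_
  simp only [Pi.mul_apply, Function.comp_apply, gapDensityDeriv]
  field_simp
  ring

theorem mul_sin_sq_add_mul_cos_pos {c κ : ℝ} (hδ : 0 < δ) (hc : c ∈ Ioo (α - δ) (α + δ))
    (hκ : 1 ≤ κ) (φ : ℝ) :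
    0 < κ * (δ * Real.sin φ) ^ 2 + (α + δ * Real.cos φ - c) * (δ * Real.cos φ) := by
  have hκ_mul : (δ * Real.sin φ) ^ 2 ≤ κ * (δ * Real.sin φ) ^ 2 :=
    le_mul_of_one_le_left (sq_nonneg _) hκ
  have hfactor : (δ * Real.sin φ) ^ 2 + (α + δ * Real.cos φ - c) * (δ * Real.cos φ)
      = δ * (δ + (α - c) * Real.cos φ) := by
    linear_combination δ ^ 2 * Real.sin_sq_add_cos_sq φ
  have habs : |(α - c) * Real.cos φ| < δ := by
    rw [abs_mul]
    refine (mul_le_of_le_one_right (abs_nonneg _) (Real.abs_cos_le_one φ)).trans_lt ?_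
    rw [abs_lt]
    constructor <;> linarith [hc.1, hc.2]
  have hpos : 0 < δ * (δ + (α - c) * Real.cos φ) :=
    mul_pos hδ (by linarith [(abs_lt.1 habs).1])
  linarith

theorem strictAntiOn_gapVariation (h : IsGap δ α) :
    StrictAntiOn (gapVariation δ α) (Ioo 0 Real.pi) := by
  refine strictAntiOn_of_hasDerivWithinAt_neg (convex_Ioo _ _)
    (fun φ hφ => (hasDerivAt_gapVariation h hφ).continuousAt.continuousWithinAt)
    (fun φ hφ => (hasDerivAt_gapVariation h (interior_subset hφ)).hasDerivWithinAt) fun φ hφ => ?_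
  obtain ⟨hφ0, hφπ⟩ : φ ∈ Ioo 0 Real.pi := interior_subset hφ
  have hsin : 0 < δ * Real.sin φ := mul_pos h.pos (Real.sin_pos_of_pos_of_lt_pi hφ0 hφπ)
  have hw := arcWeight_pos (h.add_mul_cos_mem_Ioo φ)
  have hfactor := mul_sin_sq_add_mul_cos_pos h.pos (gapCenter_mem h) (one_le_gapCenterDeriv h) φ
  exact neg_neg_of_pos (by positivity)

theorem tendsto_gapVariation_numerator (h : IsGap δ α) {l : Filter ℝ} {φ₀ : ℝ} (hl : l ≤ 𝓝 φ₀) :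
    Tendsto (fun φ => (α + δ * Real.cos φ - gapCenter δ α) * arcWeight (α + δ * Real.cos φ) / δ) l
      (𝓝 ((α + δ * Real.cos φ₀ - gapCenter δ α) * arcWeight (α + δ * Real.cos φ₀) / δ)) := by
  have hcont : Continuous fun φ =>
      (α + δ * Real.cos φ - gapCenter δ α) * arcWeight (α + δ * Real.cos φ) / δ :=
    (continuous_comp_arc (continuousOn_sub_mul continuousOn_arcWeight _) h).div_const δ
  exact (hcont.tendsto φ₀).mono_left hl

theorem tendsto_arcIntegral_gapDensityDeriv (h : IsGap δ α) {l : Filter ℝ} {φ₀ : ℝ}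
    (hl : l ≤ 𝓝 φ₀) :
    Tendsto (fun φ => arcIntegral (gapDensityDeriv δ α) δ α φ) l
      (𝓝 (arcIntegral (gapDensityDeriv δ α) δ α φ₀)) :=
  (hasDerivAt_arcIntegral_angle (continuousOn_gapDensityDeriv δ α) h
    φ₀).continuousAt.tendsto.mono_left hl

theorem gapVariation_eq_mul_inv_sin (δ α φ : ℝ) :
    gapVariation δ α φ =
      (α + δ * Real.cos φ - gapCenter δ α) * arcWeight (α + δ * Real.cos φ) / δ * (Real.sin φ)⁻¹ +
        arcIntegral (gapDensityDeriv δ α) δ α φ := by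
  rw [gapVariation, ← div_div, div_eq_mul_inv _ (Real.sin φ)]

theorem tendsto_gapVariation_zero (h : IsGap δ α) : Tendsto (gapVariation δ α) (𝓝[>] 0) atTop := by
  have hpos : 0 < (α + δ * Real.cos 0 - gapCenter δ α) * arcWeight (α + δ * Real.cos 0) / δ := by
    rw [Real.cos_zero, mul_one]
    exact div_pos (mul_pos (sub_pos.2 (gapCenter_mem h).2)
      (arcWeight_pos (h.Icc_subset ⟨h.sub_lt_add.le, le_rfl⟩))) h.pos
  have hsin : Tendsto Real.sin (𝓝[>] 0) (𝓝[>] 0) := by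
    refine tendsto_nhdsWithin_iff.2
      ⟨(Real.continuous_sin.tendsto' 0 0 Real.sin_zero).mono_left nhdsWithin_le_nhds, ?_⟩
    filter_upwards [Ioo_mem_nhdsGT Real.pi_pos] with φ hφ
    exact Real.sin_pos_of_pos_of_lt_pi hφ.1 hφ.2
  simp only [funext (gapVariation_eq_mul_inv_sin δ α)]
  exact ((tendsto_gapVariation_numerator h nhdsWithin_le_nhds).pos_mul_atTop hpos
    (tendsto_inv_nhdsGT_zero.comp hsin)).atTop_add
      (tendsto_arcIntegral_gapDensityDeriv h nhdsWithin_le_nhds)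

theorem tendsto_gapVariation_pi (h : IsGap δ α) :
    Tendsto (gapVariation δ α) (𝓝[<] Real.pi) atBot := by
  have hneg : (α + δ * Real.cos Real.pi - gapCenter δ α) * arcWeight (α + δ * Real.cos Real.pi) / δ
      < 0 := by
    rw [Real.cos_pi, mul_neg_one, ← sub_eq_add_neg]
    exact div_neg_of_neg_of_pos (mul_neg_of_neg_of_pos (sub_neg.2 (gapCenter_mem h).1)
      (arcWeight_pos (h.Icc_subset ⟨le_rfl, h.sub_lt_add.le⟩))) h.pos
  have hsin : Tendsto Real.sin (𝓝[<] Real.pi) (𝓝[>] 0) := by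
    refine tendsto_nhdsWithin_iff.2
      ⟨(Real.continuous_sin.tendsto' Real.pi 0 Real.sin_pi).mono_left nhdsWithin_le_nhds, ?_⟩
    filter_upwards [Ioo_mem_nhdsLT Real.pi_pos] with φ hφ
    exact Real.sin_pos_of_pos_of_lt_pi hφ.1 hφ.2
  simp only [funext (gapVariation_eq_mul_inv_sin δ α)]
  exact ((tendsto_gapVariation_numerator h nhdsWithin_le_nhds).neg_mul_atTop hneg
    (tendsto_inv_nhdsGT_zero.comp hsin)).atBot_add
      (tendsto_arcIntegral_gapDensityDeriv h nhdsWithin_le_nhds)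

theorem exists_gapVariation_eq_zero (h : IsGap δ α) :
    ∃ φ ∈ Ioo 0 Real.pi, gapVariation δ α φ = 0 := by
  obtain ⟨φ₁, hpos, hφ₁⟩ := ((tendsto_gapVariation_zero h).eventually_ge_atTop 0 |>.and
    (Ioo_mem_nhdsGT (half_pos Real.pi_pos))).exists
  obtain ⟨φ₂, hneg, hφ₂⟩ := ((tendsto_gapVariation_pi h).eventually_le_atBot 0 |>.and
    (Ioo_mem_nhdsLT (half_lt_self Real.pi_pos))).exists
  have hsub : Icc φ₁ φ₂ ⊆ Ioo 0 Real.pi := Icc_subset_Ioo hφ₁.1 hφ₂.2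
  obtain ⟨φ, hφ, hzero⟩ := intermediate_value_Icc' (hφ₁.2.trans hφ₂.1).le (f := gapVariation δ α)
    (fun ψ hψ => (hasDerivAt_gapVariation h (hsub hψ)).continuousAt.continuousWithinAt)
    ⟨hneg, hpos⟩
  exact ⟨φ, hsub hφ, hzero⟩

end Variation

/-! ### The limit of a gap reaching the left end point -/

section LeftEndPoint

variable {δ α φ x : ℝ} {v : ℝ → ℝ}

/-- The density `√((1 + t) / (1 - t))` of the Green function in the limit where the left interval
shrinks to a point, modified for `t > δ` so that it is continuous on the real line. -/
noncomputable def limitWeight (δ t : ℝ) : ℝ := √((1 + t) / max (1 - t) (1 - δ))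

theorem eventually_isGap_nhdsGT (hδ : 0 < δ) (hδ1 : δ < 1) :
    ∀ᶠ α in 𝓝[>] (δ - 1), IsGap δ α ∧ α ≤ 0 := by
  filter_upwards [Ioc_mem_nhdsGT (sub_neg.2 hδ1)] with α hα
  exact ⟨.of_mem_Ioc hδ hδ1 hα, hα.2⟩

theorem one_le_arcWeight {t : ℝ} (ht : t ∈ Ioo (-1 : ℝ) 1) : 1 ≤ arcWeight t :=
  (one_le_inv₀ (Real.sqrt_pos.2 (one_sub_sq_pos ht))).2
    (Real.sqrt_le_iff.2 ⟨zero_le_one, by nlinarith [sq_nonneg t]⟩)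

theorem arcWeight_le {t : ℝ} (hx : -1 < x) (hxt : x ≤ t) (ht : t ≤ δ) (hδ1 : δ < 1) :
    arcWeight t ≤ (√((1 - δ) * (1 + x)))⁻¹ := by
  refine inv_anti₀ (Real.sqrt_pos.2 (mul_pos (by linarith) (by linarith))) (Real.sqrt_le_sqrt ?_)
  rw [show 1 - t ^ 2 = (1 - t) * (1 + t) by ring]
  exact mul_le_mul (by linarith) (by linarith) (by linarith) (by linarith)

theorem continuous_limitWeight (hδ1 : δ < 1) : Continuous (limitWeight δ) :=
  Real.continuous_sqrt.comp (Continuous.div (by fun_prop) (by fun_prop) fun _ =>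
    (lt_max_of_lt_right (sub_pos.2 hδ1)).ne')

theorem limitWeight_eq {t : ℝ} (ht : t ∈ Ioo (-1 : ℝ) 1) (htδ : t ≤ δ) :
    limitWeight δ t = (t + 1) * arcWeight t := by
  have hsub : 0 < 1 - t := by linarith [ht.2]
  have hadd : 0 < 1 + t := by linarith [ht.1]
  rw [limitWeight, max_eq_left (by linarith)]
  refine (Real.sqrt_eq_iff_mul_self_eq_of_pos (mul_pos (by linarith) (arcWeight_pos ht))).2 ?_
  rw [← pow_two, mul_pow, arcWeight_sq ht, show 1 - t ^ 2 = (1 - t) * (1 + t) by ring]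
  field_simp
  ring

theorem limitWeight_le {t : ℝ} (hδ1 : δ < 1) (ht : t ≤ 1) : limitWeight δ t ≤ √(2 / (1 - δ)) :=
  Real.sqrt_le_sqrt (div_le_div₀ zero_le_two (by linarith) (sub_pos.2 hδ1) (le_max_right _ _))

theorem inv_add_pi_sub_le_arcWeight (h : IsGap δ α) {θ : ℝ} (hθ : θ ≤ Real.pi) :
    1 / 2 * (√(α - δ + 1) + Real.pi - θ)⁻¹ ≤ arcWeight (α + δ * Real.cos θ) := by
  obtain ⟨hδ, hlow, hhigh⟩ := h
  have hη : 0 < √(α - δ + 1) := Real.sqrt_pos.2 (by linarith)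
  have hη2 : √(α - δ + 1) ^ 2 = α - δ + 1 := Real.sq_sqrt (by linarith)
  have hpos : 0 < √(α - δ + 1) + Real.pi - θ := by linarith
  have ht := IsGap.add_mul_cos_mem_Ioo ⟨hδ, hlow, hhigh⟩ θ
  rw [arcWeight, one_div, ← mul_inv]
  refine inv_anti₀ (Real.sqrt_pos.2 (one_sub_sq_pos ht)) ((Real.sqrt_le_left (by positivity)).2 ?_)
  have hcos := Real.one_sub_sq_div_two_le_cos (x := Real.pi - θ)
  rw [Real.cos_pi_sub] at hcos
  have hadd : 1 + (α + δ * Real.cos θ) ≤ √(α - δ + 1) ^ 2 + δ * ((Real.pi - θ) ^ 2 / 2) := by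
    rw [hη2]
    nlinarith
  have hfactor : 1 - (α + δ * Real.cos θ) ^ 2 ≤ 2 * (1 + (α + δ * Real.cos θ)) := by
    nlinarith [ht.1]
  nlinarith [sq_nonneg (Real.pi - θ), mul_nonneg hη.le (sub_nonneg.2 hθ)]

theorem neg_log_sqrt_le_arcIntegral_arcWeight (h : IsGap δ α) :
    -(1 / 2 * Real.log √(α - δ + 1)) ≤ arcIntegral arcWeight δ α 0 := by
  have hη : 0 < √(α - δ + 1) := Real.sqrt_pos.2 (by linarith [h.neg_one_lt])
  set η := √(α - δ + 1)
  have hlog : 0 ≤ Real.log (η + Real.pi) := Real.log_nonneg (by linarith [Real.pi_gt_three])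
  have hcont : ContinuousOn (fun θ => 1 / 2 * (η + Real.pi - θ)⁻¹) (uIcc 0 Real.pi) := by
    refine continuousOn_const.mul (ContinuousOn.inv₀ (by fun_prop) fun θ hθ => ?_)
    rw [uIcc_of_le Real.pi_pos.le] at hθ
    linarith [hθ.2]
  calc -(1 / 2 * Real.log η)
      ≤ 1 / 2 * (Real.log (η + Real.pi) - Real.log η) := by linarith
    _ = ∫ θ in (0 : ℝ)..Real.pi, 1 / 2 * (η + Real.pi - θ)⁻¹ := by
      rw [intervalIntegral.integral_const_mul,
        intervalIntegral.integral_comp_sub_left (fun y => y⁻¹), add_sub_cancel_right, sub_zero,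
        integral_inv_of_pos hη (by positivity), Real.log_div (by positivity) hη.ne']
    _ ≤ arcIntegral arcWeight δ α 0 :=
      intervalIntegral.integral_mono_on Real.pi_pos.le hcont.intervalIntegrable
        ((continuous_comp_arc continuousOn_arcWeight h).intervalIntegrable _ _)
        fun θ hθ => inv_add_pi_sub_le_arcWeight h hθ.2

theorem tendsto_arcIntegral_arcWeight (hδ : 0 < δ) (hδ1 : δ < 1) :
    Tendsto (fun α => arcIntegral arcWeight δ α 0) (𝓝[>] (δ - 1)) atTop := by
  have hη : Tendsto (fun α => √(α - δ + 1)) (𝓝[>] (δ - 1)) (𝓝[>] 0) := by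
    refine tendsto_nhdsWithin_iff.2 ⟨?_, ?_⟩
    · exact (Continuous.tendsto' (by fun_prop) _ _ (by simp)).mono_left nhdsWithin_le_nhds
    · filter_upwards [self_mem_nhdsWithin] with α hα
      exact Real.sqrt_pos.2 (by linarith [mem_Ioi.1 hα])
  have hlog := (Real.tendsto_log_nhdsGT_zero.comp hη).const_mul_atBot (one_half_pos (α := ℝ))
  refine tendsto_atTop_mono' _ ?_ (tendsto_neg_atBot_atTop.comp hlog)
  exact (eventually_isGap_nhdsGT hδ hδ1).mono fun α hα => neg_log_sqrt_le_arcIntegral_arcWeight hα.1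

theorem arcIntegral_const (k δ α : ℝ) : arcIntegral (fun _ => k) δ α 0 = Real.pi * k := by
  simp [arcIntegral]

theorem arcIntegral_add_one (δ α : ℝ) : arcIntegral (fun t => t + 1) δ α 0 = Real.pi * (α + 1) := by
  have hcos : IntervalIntegrable (fun θ => δ * Real.cos θ) MeasureTheory.volume 0 Real.pi :=
    Continuous.intervalIntegrable (by fun_prop) _ _
  rw [arcIntegral, intervalIntegral.integral_add (intervalIntegrable_const.add hcos)
    intervalIntegrable_const, intervalIntegral.integral_add intervalIntegrable_const hcos,
    intervalIntegral.integral_const_mul, integral_cos]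
  simp
  ring

theorem gapCenter_add_one_mul (h : IsGap δ α) :
    (gapCenter δ α + 1) * arcIntegral arcWeight δ α 0
      = arcIntegral (fun t => (t + 1) * arcWeight t) δ α 0 := by
  simpa only [sub_neg_eq_add] using gapCenter_sub_mul h (-1)

theorem continuousOn_add_one_mul_arcWeight :
    ContinuousOn (fun t => (t + 1) * arcWeight t) (Ioo (-1) 1) := by
  simpa only [sub_neg_eq_add] using continuousOn_sub_mul continuousOn_arcWeight (-1)

theorem gapCenter_add_one_mul_le (h : IsGap δ α) (hα : α ≤ 0) :
    (gapCenter δ α + 1) * arcIntegral arcWeight δ α 0 ≤ Real.pi * √(2 / (1 - δ)) := by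
  have hδ1 : δ < 1 := by linarith [h.neg_one_lt]
  rw [gapCenter_add_one_mul h, ← arcIntegral_const _ δ α]
  refine arcIntegral_mono continuousOn_add_one_mul_arcWeight continuousOn_const h
    (fun t ht => ?_) Real.pi_pos.le
  rw [← limitWeight_eq (h.Icc_subset ht) (by linarith [ht.2] : t ≤ δ)]
  exact limitWeight_le hδ1 (h.Icc_subset ht).2.le

theorem pi_mul_le_gapCenter_add_one_mul (h : IsGap δ α) :
    Real.pi * δ ≤ (gapCenter δ α + 1) * arcIntegral arcWeight δ α 0 := by
  calc Real.pi * δ ≤ Real.pi * (α + 1) :=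
        mul_le_mul_of_nonneg_left (by linarith [h.neg_one_lt]) Real.pi_pos.le
    _ = arcIntegral (fun t => t + 1) δ α 0 := (arcIntegral_add_one δ α).symm
    _ ≤ arcIntegral (fun t => (t + 1) * arcWeight t) δ α 0 :=
        arcIntegral_mono (by fun_prop) continuousOn_add_one_mul_arcWeight h (fun t ht =>
          le_mul_of_one_le_right (by linarith [(h.Icc_subset ht).1])
            (one_le_arcWeight (h.Icc_subset ht))) Real.pi_pos.le
    _ = _ := (gapCenter_add_one_mul h).symm

theorem gapCenter_add_one_pos (h : IsGap δ α) : 0 < gapCenter δ α + 1 := by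
  linarith [(gapCenter_mem h).1, h.neg_one_lt]

theorem tendsto_gapCenter_add_one (hδ : 0 < δ) (hδ1 : δ < 1) :
    Tendsto (fun α => gapCenter δ α + 1) (𝓝[>] (δ - 1)) (𝓝 0) := by
  have hgap := eventually_isGap_nhdsGT hδ hδ1
  refine squeeze_zero' (hgap.mono fun α hα => (gapCenter_add_one_pos hα.1).le)
    (hgap.mono fun α hα => ?_)
    ((tendsto_arcIntegral_arcWeight hδ hδ1).const_div_atTop (Real.pi * √(2 / (1 - δ))))
  rw [le_div_iff₀ (arcIntegral_arcWeight_pos hα.1 ⟨le_rfl, Real.pi_pos⟩)]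
  exact gapCenter_add_one_mul_le hα.1 hα.2

theorem le_sub_mul_arcWeightDeriv {c t : ℝ} (hδ1 : δ < 1) (hc : c ∈ Ioo (-1 : ℝ) 1)
    (ht : t ∈ Ioo (-1 : ℝ) 1) (htδ : t ≤ δ) :
    (1 + c) * (1 - δ) / 2 * arcWeight t ^ 3 - (1 / (1 - δ) + 1 / 2) * arcWeight t
      ≤ (t - c) * arcWeightDeriv t := by
  have hw := arcWeight_pos ht
  have hδ' : 0 < 1 - δ := sub_pos.2 hδ1
  have hsub : 0 < 1 - t := by linarith
  have hadd : 0 < 1 + t := by linarith [ht.1]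
  have hcube : arcWeight t ^ 3 = arcWeight t / ((1 - t) * (1 + t)) := by
    rw [pow_succ, arcWeight_sq ht, show 1 - t ^ 2 = (1 - t) * (1 + t) by ring]
    field_simp
  have hsplit : (t - c) * arcWeightDeriv t = (1 + c) * (1 - t) / 2 * arcWeight t ^ 3
      - ((c - t) / (2 * (1 - t)) + 1 / 2) * arcWeight t := by
    rw [arcWeightDeriv, hcube]
    field_simp
    ring
  have hfirst : (1 + c) * (1 - δ) / 2 ≤ (1 + c) * (1 - t) / 2 := by
    have : 0 < 1 + c := by linarith [hc.1]
    gcongr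
  have hsecond : (c - t) / (2 * (1 - t)) ≤ 1 / (1 - δ) := by
    rw [div_le_div_iff₀ (by positivity) hδ']
    nlinarith [ht.1, hc.2]
  rw [hsplit]
  gcongr

theorem pow_three_div_le_arcIntegral_arcWeight_pow_three (h : IsGap δ α) :
    arcIntegral arcWeight δ α 0 ^ 3 / Real.pi ^ 2
      ≤ arcIntegral (fun t => arcWeight t ^ 3) δ α 0 := by
  set W := arcIntegral arcWeight δ α 0 with hW
  have hl : 0 < W / Real.pi :=
    div_pos (arcIntegral_arcWeight_pos h ⟨le_rfl, Real.pi_pos⟩) Real.pi_pos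
  set l := W / Real.pi with hl_def
  -- the tangent to `w ↦ w ^ 3` at the mean value `l` of `arcWeight`
  have htangent : ∀ t ∈ Icc (α - δ) (α + δ), 3 * l ^ 2 * arcWeight t + -(2 * l ^ 3)
      ≤ arcWeight t ^ 3 := fun t ht => by
    have hw := arcWeight_pos (h.Icc_subset ht)
    nlinarith [mul_nonneg (by positivity : 0 ≤ arcWeight t + 2 * l) (sq_nonneg (arcWeight t - l))]
  have hcont : ContinuousOn (fun t => 3 * l ^ 2 * arcWeight t) (Ioo (-1) 1) :=
    continuousOn_const.mul continuousOn_arcWeight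
  have hmono := arcIntegral_mono (hcont.add continuousOn_const) (continuousOn_arcWeight.pow 3) h
    htangent Real.pi_pos.le
  refine le_trans (le_of_eq ?_) hmono
  change _ = arcIntegral (fun t => 3 * l ^ 2 * arcWeight t + -(2 * l ^ 3)) δ α 0
  rw [arcIntegral_add hcont continuousOn_const h, arcIntegral_const_mul, arcIntegral_const, ← hW,
    hl_def]
  field_simp
  ring

theorem le_gapCenterDeriv_sub_one (h : IsGap δ α) (hα : α ≤ 0) :
    δ * (1 - δ) / (2 * Real.pi) * arcIntegral arcWeight δ α 0 - (1 / (1 - δ) + 1 / 2)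
      ≤ gapCenterDeriv δ α - 1 := by
  have hδ1 : δ < 1 := by linarith [h.neg_one_lt]
  have hW := arcIntegral_arcWeight_pos h ⟨le_rfl, Real.pi_pos⟩
  have hcube := pow_three_div_le_arcIntegral_arcWeight_pow_three h
  have hcW := pi_mul_le_gapCenter_add_one_mul h
  have hc := h.Icc_subset (Ioo_subset_Icc_self (gapCenter_mem h))
  have hcont (k : ℝ) : ContinuousOn (fun t => k * arcWeight t ^ 3) (Ioo (-1) 1) :=
    continuousOn_const.mul (continuousOn_arcWeight.pow 3)
  have hcont' (k : ℝ) : ContinuousOn (fun t => -k * arcWeight t) (Ioo (-1) 1) :=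
    continuousOn_const.mul continuousOn_arcWeight
  have hmono := arcIntegral_mono ((hcont ((1 + gapCenter δ α) * (1 - δ) / 2)).fun_add
    (hcont' (1 / (1 - δ) + 1 / 2))) (continuousOn_sub_mul continuousOn_arcWeightDeriv _) h
    (fun t ht => by
      simpa only [neg_mul, ← sub_eq_add_neg] using
        le_sub_mul_arcWeightDeriv hδ1 hc (h.Icc_subset ht) (by linarith [ht.2])) Real.pi_pos.le
  rw [arcIntegral_add (hcont _) (hcont' _) h, arcIntegral_const_mul, arcIntegral_const_mul] at hmono
  rw [gapCenterDeriv, add_sub_cancel_left, le_div_iff₀ hW]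
  refine le_trans ?_ hmono
  set W := arcIntegral arcWeight δ α 0
  calc (δ * (1 - δ) / (2 * Real.pi) * W - (1 / (1 - δ) + 1 / 2)) * W
      = (1 - δ) / (2 * Real.pi ^ 2) * W ^ 2 * (Real.pi * δ)
          + -(1 / (1 - δ) + 1 / 2) * W := by
        field_simp
        ring
    _ ≤ (1 - δ) / (2 * Real.pi ^ 2) * W ^ 2 * ((gapCenter δ α + 1) * W)
          + -(1 / (1 - δ) + 1 / 2) * W := by
        have := sub_pos.2 hδ1
        gcongr
    _ = (1 + gapCenter δ α) * (1 - δ) / 2 * (W ^ 3 / Real.pi ^ 2)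
          + -(1 / (1 - δ) + 1 / 2) * W := by ring
    _ ≤ _ := by
        have := sub_pos.2 hδ1
        have := gapCenter_add_one_pos h
        have : 0 < 1 + gapCenter δ α := by linarith
        gcongr

theorem tendsto_gapCenterDeriv_sub_one (hδ : 0 < δ) (hδ1 : δ < 1) :
    Tendsto (fun α => gapCenterDeriv δ α - 1) (𝓝[>] (δ - 1)) atTop := by
  have hfactor : 0 < δ * (1 - δ) / (2 * Real.pi) :=
    div_pos (mul_pos hδ (sub_pos.2 hδ1)) (mul_pos two_pos Real.pi_pos)
  exact tendsto_atTop_mono' _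
    ((eventually_isGap_nhdsGT hδ hδ1).mono fun α hα => le_gapCenterDeriv_sub_one hα.1 hα.2)
    (tendsto_atTop_add_const_right _ (-(1 / (1 - δ) + 1 / 2))
      ((tendsto_arcIntegral_arcWeight hδ hδ1).const_mul_atTop hfactor))

theorem arcIntegral_zero_sub (hv : ContinuousOn v (Ioo (-1) 1)) (h : IsGap δ α) (φ : ℝ) :
    arcIntegral v δ α 0 - arcIntegral v δ α φ = ∫ θ in (0 : ℝ)..φ, v (α + δ * Real.cos θ) := by
  have hc := continuous_comp_arc hv h
  rw [arcIntegral, arcIntegral, sub_eq_iff_eq_add]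
  exact (intervalIntegral.integral_add_adjacent_intervals (hc.intervalIntegrable _ _)
    (hc.intervalIntegrable _ _)).symm

theorem add_mul_cos_arccos (hδ : 0 < δ) (hx : x ∈ Icc (α - δ) (α + δ)) :
    α + δ * Real.cos (Real.arccos ((x - α) / δ)) = x := by
  rw [Real.cos_arccos, mul_div_cancel₀ _ hδ.ne', add_sub_cancel]
  · rw [le_div_iff₀ hδ]
    linarith [hx.1]
  · rw [div_le_iff₀ hδ]
    linarith [hx.2]

theorem add_mul_cos_le_add_mul_cos (hδ : 0 < δ) (α : ℝ) {θ : ℝ} (hθ : θ ∈ Icc 0 φ)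
    (hφ : φ ≤ Real.pi) : α + δ * Real.cos φ ≤ α + δ * Real.cos θ :=
  add_le_add_right (mul_le_mul_of_nonneg_left
    (Real.cos_le_cos_of_nonneg_of_le_pi hθ.1 hφ hθ.2) hδ.le) α

theorem le_gapDensityDeriv (h : IsGap δ α) (hα : α ≤ 0) (hx : -1 < x) {t : ℝ}
    (ht : t ∈ Icc (α - δ) (α + δ)) (hxt : x ≤ t) :
    gapCenterDeriv δ α - 1 - 2 * (√((1 - δ) * (1 + x)))⁻¹ ^ 3 ≤ gapDensityDeriv δ α t := by
  have ht1 := h.Icc_subset ht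
  have hc := h.Icc_subset (Ioo_subset_Icc_self (gapCenter_mem h))
  have hw := arcWeight_pos ht1
  have hwx := arcWeight_le hx hxt (by linarith [ht.2] : t ≤ δ) (by linarith [h.neg_one_lt])
  set L := (√((1 - δ) * (1 + x)))⁻¹
  have hmain : gapCenterDeriv δ α - 1 ≤ (gapCenterDeriv δ α - 1) * arcWeight t :=
    le_mul_of_one_le_right (sub_nonneg.2 (one_le_gapCenterDeriv h)) (one_le_arcWeight ht1)
  have herror : (t - gapCenter δ α) * arcWeightDeriv t ≤ 2 * L ^ 3 := by
    rw [arcWeightDeriv, ← mul_assoc]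
    refine mul_le_mul ?_ (pow_le_pow_left₀ hw.le hwx 3) (by positivity) zero_le_two
    nlinarith [ht1.1, ht1.2, hc.1, hc.2]
  exact sub_le_sub hmain herror

theorem gapVariation_le (h : IsGap δ α) (hα : α ≤ 0) (hφ : φ ∈ Ioo 0 Real.pi)
    (hx : α + δ * Real.cos φ = x) :
    gapVariation δ α φ ≤ 2 * (√((1 - δ) * (1 + x)))⁻¹ / (δ * Real.sin φ) +
      -(φ * (gapCenterDeriv δ α - 1 - 2 * (√((1 - δ) * (1 + x)))⁻¹ ^ 3)) := by
  have hxg : x ∈ Icc (α - δ) (α + δ) := hx ▸ h.add_mul_cos_mem_Icc φ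
  have hx1 := h.Icc_subset hxg
  have hc := h.Icc_subset (Ioo_subset_Icc_self (gapCenter_mem h))
  have hsin := mul_pos h.pos (Real.sin_pos_of_pos_of_lt_pi hφ.1 hφ.2)
  have hwx := arcWeight_le hx1.1 le_rfl (by linarith [hxg.2] : x ≤ δ) (by linarith [h.neg_one_lt])
  have hmono := intervalIntegral.integral_mono_on (μ := MeasureTheory.volume) hφ.1.le
    intervalIntegrable_const
    ((continuous_comp_arc (continuousOn_gapDensityDeriv δ α) h).intervalIntegrable _ _) fun θ hθ =>
      le_gapDensityDeriv h hα hx1.1 (h.add_mul_cos_mem_Icc θ)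
        (hx ▸ add_mul_cos_le_add_mul_cos h.pos α hθ hφ.2.le)
  rw [intervalIntegral.integral_const, sub_zero, smul_eq_mul,
    ← arcIntegral_zero_sub (continuousOn_gapDensityDeriv δ α) h,
    arcIntegral_gapDensityDeriv_zero h, zero_sub] at hmono
  rw [gapVariation, hx]
  refine add_le_add (div_le_div_of_nonneg_right ?_ hsin.le) (le_neg_of_le_neg hmono)
  exact mul_le_mul (by linarith [hx1.2, hc.1]) hwx (arcWeight_pos hx1).le zero_le_two

theorem IsGap.arccos_mem_Ioo (h : IsGap δ α) (hx : x ∈ Ioo (α - δ) (α + δ)) :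
    Real.arccos ((x - α) / δ) ∈ Ioo 0 Real.pi :=
  ⟨Real.arccos_pos.2 (h.sub_div_mem_Ioo hx).2, Real.arccos_lt_pi.2 (h.sub_div_mem_Ioo hx).1⟩

theorem eventually_mem_gap (hx : x ∈ Ioo (-1) (-1 + 2 * δ)) :
    ∀ᶠ α in 𝓝[>] (δ - 1), x ∈ Ioo (α - δ) (α + δ) := by
  refine Filter.Eventually.filter_mono nhdsWithin_le_nhds ?_
  filter_upwards [gt_mem_nhds (by linarith [hx.1] : δ - 1 < x + δ),
    lt_mem_nhds (by linarith [hx.2] : x - δ < δ - 1)] with α hlow hhigh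
  constructor <;> linarith

theorem tendsto_arccos_left (δ x : ℝ) : Tendsto (fun α => Real.arccos ((x - α) / δ)) (𝓝[>] (δ - 1))
    (𝓝 (Real.arccos ((x - (δ - 1)) / δ))) :=
  (Continuous.tendsto (by fun_prop) _).mono_left nhdsWithin_le_nhds

theorem eventually_gapVariation_neg (hδ : 0 < δ) (hδ1 : δ < 1) (hx : x ∈ Ioo (-1) (-1 + 2 * δ)) :
    ∀ᶠ α in 𝓝[>] (δ - 1), gapVariation δ α (Real.arccos ((x - α) / δ)) < 0 := by
  set L := (√((1 - δ) * (1 + x)))⁻¹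
  set φ₀ := Real.arccos ((x - (δ - 1)) / δ)
  have hφ : Tendsto _ _ (𝓝 φ₀) := tendsto_arccos_left δ x
  have hφ₀ : φ₀ ∈ Ioo 0 Real.pi := by
    rw [mem_Ioo, Real.arccos_pos, Real.arccos_lt_pi, div_lt_one hδ, lt_div_iff₀ hδ]
    constructor <;> linarith [hx.1, hx.2]
  have hbounded := (tendsto_const_nhds (x := 2 * L)).div
    (((Real.continuous_sin.tendsto _).comp hφ).const_mul δ)
    (mul_pos hδ (Real.sin_pos_of_pos_of_lt_pi hφ₀.1 hφ₀.2)).ne'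
  have hunbounded := tendsto_neg_atTop_atBot.comp (hφ.pos_mul_atTop hφ₀.1
    (tendsto_atTop_add_const_right _ (-(2 * L ^ 3)) (tendsto_gapCenterDeriv_sub_one hδ hδ1)))
  filter_upwards [(hbounded.add_atBot hunbounded).eventually_lt_atBot 0, eventually_mem_gap hx,
    eventually_isGap_nhdsGT hδ hδ1] with α hneg hgap ⟨h, hα⟩
  exact (gapVariation_le h hα (h.arccos_mem_Ioo hgap)
    (add_mul_cos_arccos hδ (Ioo_subset_Icc_self hgap))).trans_lt hneg

theorem gapGreen_eq_sub (h : IsGap δ α) (φ : ℝ) :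
    gapGreen δ α φ =
      (∫ θ in (0 : ℝ)..φ, (α + δ * Real.cos θ + 1) * arcWeight (α + δ * Real.cos θ)) -
        (gapCenter δ α + 1) * ∫ θ in (0 : ℝ)..φ, arcWeight (α + δ * Real.cos θ) := by
  have hsum (ψ : ℝ) := arcIntegral_sub_mul continuousOn_arcWeight h (-1) ψ
  simp only [sub_neg_eq_add] at hsum
  rw [← arcIntegral_zero_sub continuousOn_arcWeight h,
    ← arcIntegral_zero_sub continuousOn_add_one_mul_arcWeight h, hsum, hsum, gapGreen,
    ← gapCenter_mul h]
  ring

theorem hasDerivAt_arcosh_one_sub_mul_cos (hδ : 0 < δ) (hδ1 : δ < 1) {θ : ℝ}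
    (hθ : θ ∈ Ioo 0 Real.pi) :
    HasDerivAt (fun θ => Real.arcosh ((1 - δ * Real.cos θ) / (1 - δ)))
      (limitWeight δ (δ - 1 + δ * Real.cos θ)) θ := by
  have hδ' : 0 < 1 - δ := sub_pos.2 hδ1
  have hsin : 0 < Real.sin θ := Real.sin_pos_of_pos_of_lt_pi hθ.1 hθ.2
  have hsin_sq : Real.sin θ ^ 2 = (1 - Real.cos θ) * (1 + Real.cos θ) := by
    linear_combination Real.sin_sq_add_cos_sq θ
  have hcos : Real.cos θ < 1 := by nlinarith [Real.cos_le_one θ]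
  have harg : 1 < (1 - δ * Real.cos θ) / (1 - δ) := by
    rw [one_lt_div hδ']
    nlinarith
  have harg_sq : 0 < ((1 - δ * Real.cos θ) / (1 - δ)) ^ 2 - 1 := by nlinarith
  have hlin :
      HasDerivAt (fun θ => (1 - δ * Real.cos θ) / (1 - δ)) (δ * Real.sin θ / (1 - δ)) θ := by
    refine ((((Real.hasDerivAt_cos θ).const_mul δ).const_sub 1).div_const (1 - δ)).congr_deriv ?_
    ring
  refine ((Real.hasDerivAt_arcosh harg).comp θ hlin).congr_deriv ?_
  have hden : 1 - (δ - 1 + δ * Real.cos θ) ≠ 0 := by nlinarith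
  rw [inv_mul_eq_iff_eq_mul₀ (Real.sqrt_pos.2 harg_sq).ne', limitWeight,
    ← Real.sqrt_mul harg_sq.le, max_eq_left (by nlinarith), eq_comm,
    Real.sqrt_eq_iff_mul_self_eq_of_pos (by positivity), ← pow_two, div_pow, mul_pow, hsin_sq]
  field_simp
  ring

theorem integral_limitWeight (hδ : 0 < δ) (hδ1 : δ < 1) (hφ : φ ∈ Icc 0 Real.pi) :
    ∫ θ in (0 : ℝ)..φ, limitWeight δ (δ - 1 + δ * Real.cos θ)
      = Real.arcosh ((1 - δ * Real.cos φ) / (1 - δ)) := by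
  have hδ' : 0 < 1 - δ := sub_pos.2 hδ1
  have hcont : ContinuousOn (fun θ => Real.arcosh ((1 - δ * Real.cos θ) / (1 - δ))) (Icc 0 φ) :=
    Real.continuousOn_arcosh.comp (by fun_prop) fun θ _ =>
      mem_Ici.2 ((one_le_div hδ').2 (by nlinarith [Real.cos_le_one θ]))
  rw [intervalIntegral.integral_eq_sub_of_hasDerivAt_of_le hφ.1 hcont
    (fun θ hθ => hasDerivAt_arcosh_one_sub_mul_cos hδ hδ1 ⟨hθ.1, hθ.2.trans_le hφ.2⟩)
    (((continuous_limitWeight hδ1).comp (by fun_prop)).intervalIntegrable _ _),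
    Real.cos_zero, mul_one, div_self hδ'.ne', Real.arcosh_zero, sub_zero]

theorem tendsto_integral_limitWeight (hδ : 0 < δ) (hδ1 : δ < 1) (hx : x ∈ Ioo (-1) (-1 + 2 * δ)) :
    Tendsto (fun α => ∫ θ in (0 : ℝ)..Real.arccos ((x - α) / δ), limitWeight δ (α + δ * Real.cos θ))
      (𝓝[>] (δ - 1)) (𝓝 (greenOne δ x)) := by
  have hcont := intervalIntegral.continuous_parametric_intervalIntegral_of_continuous
    (f := fun α θ => limitWeight δ (α + δ * Real.cos θ)) (μ := MeasureTheory.volume) (a₀ := 0)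
    (s := fun α => Real.arccos ((x - α) / δ))
    ((continuous_limitWeight hδ1).comp (by fun_prop)) (by fun_prop)
  have hx' := add_mul_cos_arccos (α := δ - 1) (x := x) hδ ⟨by linarith [hx.1], by linarith [hx.2]⟩
  refine (hcont.tendsto' _ _ ?_).mono_left nhdsWithin_le_nhds
  rw [integral_limitWeight hδ hδ1 ⟨Real.arccos_nonneg _, Real.arccos_le_pi _⟩,
    greenOne_eq_arcosh hδ1 (by linarith [hx.2]), max_eq_right]
  · congr 2
    linarith
  · rw [one_le_div (sub_pos.2 hδ1)]
    linarith [hx.2]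

theorem tendsto_gapCenter_add_one_mul_integral (hδ : 0 < δ) (hδ1 : δ < 1)
    (hx : x ∈ Ioo (-1) (-1 + 2 * δ)) :
    Tendsto (fun α => (gapCenter δ α + 1) *
      ∫ θ in (0 : ℝ)..Real.arccos ((x - α) / δ), arcWeight (α + δ * Real.cos θ))
      (𝓝[>] (δ - 1)) (𝓝 0) := by
  have hgap := (eventually_mem_gap hx).and (eventually_isGap_nhdsGT hδ hδ1)
  set L := (√((1 - δ) * (1 + x)))⁻¹
  have hL0 : 0 ≤ L := by positivity
  have hbound := (tendsto_gapCenter_add_one hδ hδ1).mul_const (L * |Real.pi|)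
  rw [zero_mul] at hbound
  refine squeeze_zero_norm' (hgap.mono fun α ⟨hxα, h, hα⟩ => ?_) hbound
  have hφ := h.arccos_mem_Ioo hxα
  have hxφ := add_mul_cos_arccos hδ (Ioo_subset_Icc_self hxα)
  rw [norm_mul, Real.norm_of_nonneg (gapCenter_add_one_pos h).le]
  refine mul_le_mul_of_nonneg_left ?_ (gapCenter_add_one_pos h).le
  refine (intervalIntegral.norm_integral_le_of_norm_le_const (C := L) fun θ hθ => ?_).trans ?_
  · rw [uIoc_of_le hφ.1.le] at hθ
    rw [Real.norm_of_nonneg (arcWeight_pos (h.add_mul_cos_mem_Ioo θ)).le]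
    exact arcWeight_le hx.1 (hxφ ▸ add_mul_cos_le_add_mul_cos hδ α (Ioc_subset_Icc_self hθ) hφ.2.le)
      (by linarith [(h.add_mul_cos_mem_Icc θ).2, hα]) hδ1
  · rw [sub_zero, abs_of_pos hφ.1, abs_of_pos Real.pi_pos]
    exact mul_le_mul_of_nonneg_left hφ.2.le hL0

theorem tendsto_greenTwo (hδ : 0 < δ) (hδ1 : δ < 1) (hx : x ∈ Ioo (-1) (-1 + 2 * δ)) :
    Tendsto (fun α => greenTwo α δ x) (𝓝[>] (δ - 1)) (𝓝 (greenOne δ x)) := by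
  have hlim := (tendsto_integral_limitWeight hδ hδ1 hx).sub
    (tendsto_gapCenter_add_one_mul_integral hδ hδ1 hx)
  rw [sub_zero] at hlim
  refine hlim.congr' ?_
  filter_upwards [eventually_isGap_nhdsGT hδ hδ1] with α ⟨h, hα⟩
  have hweight (θ : ℝ) : limitWeight δ (α + δ * Real.cos θ) =
      (α + δ * Real.cos θ + 1) * arcWeight (α + δ * Real.cos θ) :=
    limitWeight_eq (h.add_mul_cos_mem_Ioo θ) (by linarith [(h.add_mul_cos_mem_Icc θ).2])
  rw [greenTwo_eq_gapGreen h ⟨hx.1.le, by linarith [hx.2]⟩, gapGreen_eq_sub h]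
  simp only [hweight]

end LeftEndPoint

/-! ### The symmetric gap -/

section SymmetricGap

variable {δ : ℝ} {v : ℝ → ℝ}

theorem two_mul_arcIntegral_pi_div_two (hv : ContinuousOn v (Ioo (-1) 1))
    (hveven : ∀ t, v (-t) = v t) (h : IsGap δ 0) :
    2 * arcIntegral v δ 0 (Real.pi / 2) = arcIntegral v δ 0 0 := by
  have hreflect (θ : ℝ) : v (0 + δ * Real.cos (Real.pi - θ)) = v (0 + δ * Real.cos θ) := by
    rw [Real.cos_pi_sub, ← hveven]
    ring_nf
  have hsymm := intervalIntegral.integral_comp_sub_left (a := 0) (b := Real.pi / 2)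
    (fun θ => v (0 + δ * Real.cos θ)) Real.pi
  simp only [hreflect, sub_zero, sub_half] at hsymm
  rw [two_mul, ← eq_sub_iff_add_eq, arcIntegral_zero_sub hv h, hsymm, arcIntegral]

theorem arcWeight_neg (t : ℝ) : arcWeight (-t) = arcWeight t := by
  rw [arcWeight, arcWeight, neg_sq]

theorem arcIntegral_eq_zero_of_odd (hv : ∀ t, v (-t) = -v t) (δ : ℝ) : arcIntegral v δ 0 0 = 0 := by
  have hreflect (θ : ℝ) : v (0 + δ * Real.cos (Real.pi - θ)) = -v (0 + δ * Real.cos θ) := by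
    rw [Real.cos_pi_sub, ← hv]
    ring_nf
  have hsymm := intervalIntegral.integral_comp_sub_left (a := 0) (b := Real.pi)
    (fun θ => v (0 + δ * Real.cos θ)) Real.pi
  simp only [hreflect, sub_self, sub_zero, intervalIntegral.integral_neg] at hsymm
  exact self_eq_neg.1 hsymm.symm

theorem gapCenter_zero (δ : ℝ) : gapCenter δ 0 = 0 := by
  rw [gapCenter, arcIntegral_eq_zero_of_odd (fun t => by rw [arcWeight_neg, neg_mul]), zero_div]

theorem gapDensityDeriv_zero_neg (δ t : ℝ) : gapDensityDeriv δ 0 (-t) = gapDensityDeriv δ 0 t := by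
  simp only [gapDensityDeriv, gapCenter_zero, arcWeightDeriv, arcWeight_neg]
  ring

theorem gapVariation_zero_pi_div_two (h : IsGap δ 0) : gapVariation δ 0 (Real.pi / 2) = 0 := by
  have hhalf := two_mul_arcIntegral_pi_div_two (continuousOn_gapDensityDeriv δ 0)
    (gapDensityDeriv_zero_neg δ) h
  rw [arcIntegral_gapDensityDeriv_zero h] at hhalf
  rw [gapVariation, Real.cos_pi_div_two, gapCenter_zero, mul_zero, add_zero, sub_zero, zero_mul,
    zero_div, zero_add]
  linarith

theorem hasDerivAt_arsinh_mul_sin (h : IsGap δ 0) (θ : ℝ) :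
    HasDerivAt (fun θ => Real.arsinh (δ * Real.sin θ / √(1 - δ ^ 2)))
      (δ * Real.cos θ * arcWeight (δ * Real.cos θ)) θ := by
  have hr2 : 0 < 1 - δ ^ 2 := one_sub_sq_pos ⟨by linarith [h.pos], by linarith [h.lt_one]⟩
  have hpos := one_sub_sq_pos (h.add_mul_cos_mem_Ioo θ)
  rw [zero_add] at hpos
  refine (((Real.hasDerivAt_sin θ).const_mul δ).div_const _).arsinh.congr_deriv ?_
  have hsum : 1 + (δ * Real.sin θ / √(1 - δ ^ 2)) ^ 2
      = (1 - (δ * Real.cos θ) ^ 2) / (1 - δ ^ 2) := by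
    rw [div_pow, Real.sq_sqrt hr2.le, eq_div_iff hr2.ne', add_mul, div_mul_cancel₀ _ hr2.ne']
    linear_combination δ ^ 2 * Real.sin_sq_add_cos_sq θ
  rw [hsum, Real.sqrt_div hpos.le, arcWeight, smul_eq_mul]
  field_simp

theorem greenTwo_zero_zero (h : IsGap δ 0) : greenTwo 0 δ 0 = Real.artanh δ := by
  have hδ : δ ∈ Ioo (-1) 1 := ⟨by linarith [h.pos], by linarith [h.lt_one]⟩
  have hcont := (continuous_comp_arc continuousOn_id_mul_arcWeight h).intervalIntegrable
    (μ := MeasureTheory.volume) (Real.pi / 2) Real.pi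
  simp only [zero_add] at hcont
  rw [greenTwo_eq_gapGreen h ⟨by norm_num, zero_le_one⟩, sub_self, zero_div, Real.arccos_zero,
    gapGreen, gapCenter_zero, zero_mul, zero_sub, arcIntegral]
  simp only [zero_add]
  rw [intervalIntegral.integral_eq_sub_of_hasDerivAt
    (fun θ _ => hasDerivAt_arsinh_mul_sin h θ) hcont, Real.sin_pi, Real.sin_pi_div_two, mul_zero,
    zero_div, Real.arsinh_zero, zero_sub, neg_neg, mul_one, ← Real.sinh_artanh hδ,
    Real.arsinh_sinh]

end SymmetricGap

/-! ### The envelope -/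

section Envelope

variable {δ α x : ℝ}

theorem greenOne_eq_log (hδ1 : δ < 1) (hx : x ≤ -1 + 2 * δ) :
    greenOne δ x = Real.log ((δ - x) / (1 - δ) + √(((δ - x) / (1 - δ)) ^ 2 - 1)) := by
  have hone : 1 ≤ (δ - x) / (1 - δ) := by
    rw [one_le_div (sub_pos.2 hδ1)]
    linarith
  rw [greenOne_eq_arcosh hδ1 (by linarith), max_eq_right hone, Real.arcosh]

theorem greenOne_eq_zero (hδ1 : δ < 1) (hx : x ∈ Icc (-1 + 2 * δ) 1) : greenOne δ x = 0 := by
  have hone : (δ - x) / (1 - δ) ≤ 1 := by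
    rw [div_le_one (sub_pos.2 hδ1)]
    linarith [hx.1]
  rw [greenOne_eq_arcosh hδ1 hx.2, max_eq_left hone, Real.arcosh_zero]

theorem greenOne_nonneg (hδ1 : δ < 1) (hx : x ≤ 1) : 0 ≤ greenOne δ x := by
  rw [greenOne_eq_arcosh hδ1 hx]
  exact Real.arcosh_nonneg (le_max_left _ _)

theorem greenOne_le_greenOne {δ' : ℝ} (h : δ ≤ δ') (hδ' : δ' < 1) (hx : x ≤ 1) :
    greenOne δ x ≤ greenOne δ' x := by
  rw [greenOne_eq_arcosh (h.trans_lt hδ') hx, greenOne_eq_arcosh hδ' hx,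
    Real.arcosh_le_arcosh (lt_max_of_lt_left one_pos) (lt_max_of_lt_left one_pos)]
  refine max_le_max_left 1 ?_
  rw [div_le_div_iff₀ (by linarith) (by linarith)]
  nlinarith

theorem tendsto_greenOne {ι : Type*} {l : Filter ι} {d y : ι → ℝ} {d₀ y₀ : ℝ}
    (hd : Tendsto d l (𝓝 d₀)) (hy : Tendsto y l (𝓝 y₀)) (hd₀ : d₀ < 1) (hy₀ : y₀ < 1) :
    Tendsto (fun i => greenOne (d i) (y i)) l (𝓝 (greenOne d₀ y₀)) := by
  have harg : Tendsto (fun i => max 1 ((d i - y i) / (1 - d i))) l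
      (𝓝[Ici 1] (max 1 ((d₀ - y₀) / (1 - d₀)))) :=
    tendsto_nhdsWithin_iff.2
      ⟨tendsto_const_nhds.max ((hd.sub hy).div (hd.const_sub 1) (sub_pos.2 hd₀).ne'),
        .of_forall fun _ => mem_Ici.2 (le_max_left _ _)⟩
  rw [greenOne_eq_arcosh hd₀ hy₀.le]
  refine ((Real.continuousOn_arcosh _ (mem_Ici.2 (le_max_left _ _))).tendsto.comp harg).congr' ?_
  filter_upwards [hd.eventually_lt_const hd₀, hy.eventually_lt_const hy₀] with i hdi hyi
  exact (greenOne_eq_arcosh hdi hyi.le).symm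

theorem tendsto_greenOne_half {y : ℝ → ℝ} {y₀ : ℝ} (hδ1 : δ < 1)
    (hy : Tendsto y (𝓝[>] (δ - 1)) (𝓝 y₀)) (hy₀ : y₀ < 1) :
    Tendsto (fun α => greenOne ((1 + α + δ) / 2) (y α)) (𝓝[>] (δ - 1)) (𝓝 (greenOne δ y₀)) := by
  have hmid : Continuous fun α : ℝ => (1 + α + δ) / 2 := by fun_prop
  have hlim := (hmid.tendsto (δ - 1)).mono_left (nhdsWithin_le_nhds (s := Ioi (δ - 1)))
  rw [show (1 + (δ - 1) + δ) / 2 = δ by ring] at hlim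
  exact tendsto_greenOne hlim hy hδ1 hy₀

theorem continuousAt_greenTwo (h : IsGap δ α) (hx : x ∈ Icc (-1 : ℝ) 1) :
    ContinuousAt (fun β => greenTwo β δ x) α := by
  have harc {v : ℝ → ℝ} (hv : ContinuousOn v (Ioo (-1) 1)) :
      ContinuousAt (fun β => arcIntegral v δ β (Real.arccos ((x - β) / δ))) α :=
    ContinuousAt.comp (f := fun β => (β, Real.arccos ((x - β) / δ)))
      (g := fun p : ℝ × ℝ => arcIntegral v δ p.1 p.2) (continuousAt_arcIntegral hv h _)
      (by fun_prop)
  have hgreen : ContinuousAt (fun β => gapGreen δ β (Real.arccos ((x - β) / δ))) α :=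
    ((hasDerivAt_gapCenter h).continuousAt.mul (harc continuousOn_arcWeight)).sub
      (harc continuousOn_id_mul_arcWeight)
  exact hgreen.congr (h.eventually.mono fun β hβ => (greenTwo_eq_gapGreen hβ hx).symm)

theorem strictMonoOn_gapVariation_arccos (h : IsGap δ α) :
    StrictMonoOn (fun x => gapVariation δ α (Real.arccos ((x - α) / δ)))
      (Ioo (α - δ) (α + δ)) := fun _ hx _ hy hxy =>
  strictAntiOn_gapVariation h (h.arccos_mem_Ioo hy) (h.arccos_mem_Ioo hx)
    (Real.arccos_lt_arccos (h.sub_div_mem_Ioo hx).1.le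
      (div_lt_div_of_pos_right (sub_lt_sub_right hxy α) h.pos) (h.sub_div_mem_Ioo hy).2.le)

theorem isGapCritical_iff (h : IsGap δ α) :
    IsGapCritical δ α x ↔
      x ∈ Ioo (α - δ) (α + δ) ∧ gapVariation δ α (Real.arccos ((x - α) / δ)) = 0 :=
  and_congr_right fun hx =>
    ⟨fun hzero => (hasDerivAt_greenTwo h hx).unique hzero,
      fun hzero => hzero ▸ hasDerivAt_greenTwo h hx⟩

theorem existsUnique_isGapCritical (h : IsGap δ α) : ∃! x, IsGapCritical δ α x := by
  simp only [isGapCritical_iff h]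
  obtain ⟨φ, hφ, hzero⟩ := exists_gapVariation_eq_zero h
  refine existsUnique_of_exists_of_unique ⟨α + δ * Real.cos φ, h.add_mul_cos_mem_gap hφ, ?_⟩ ?_
  · rwa [add_sub_cancel_left, mul_div_cancel_left₀ _ h.pos.ne', Real.arccos_cos hφ.1.le hφ.2.le]
  · rintro x y ⟨hx, hx0⟩ ⟨hy, hy0⟩
    exact (strictMonoOn_gapVariation_arccos h).injOn hx hy (hx0.trans hy0.symm)

theorem isGapCritical_zero_zero (h : IsGap δ 0) : IsGapCritical δ 0 0 := by
  refine (isGapCritical_iff h).2 ⟨⟨by linarith [h.pos], by linarith [h.pos]⟩, ?_⟩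
  rw [sub_self, zero_div, Real.arccos_zero, gapVariation_zero_pi_div_two h]

theorem greenTwo_le_Phi (hδ : 0 < δ) (hδ1 : δ < 1) (hα : α ∈ Ioc (δ - 1) 0) (hx : x ≤ 1) :
    greenTwo α δ x ≤ Phi δ x := by
  refine le_csSup ⟨greenOne ((1 + δ) / 2) x, ?_⟩ ⟨α, hα, rfl⟩
  rintro _ ⟨β, hβ, rfl⟩
  exact (greenTwo_le_greenOne (.of_mem_Ioc hδ hδ1 hβ) x).trans
    (greenOne_le_greenOne (by linarith [hβ.2]) (by linarith) hx)

theorem Phi_le {M : ℝ} (hδ1 : δ < 1) (hM : ∀ α ∈ Ioc (δ - 1) 0, greenTwo α δ x ≤ M) :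
    Phi δ x ≤ M :=
  csSup_le ⟨_, 0, ⟨sub_neg.2 hδ1, le_rfl⟩, rfl⟩ (forall_mem_image.2 hM)

theorem greenOne_le_Phi (hδ : 0 < δ) (hδ1 : δ < 1) (hx : x ∈ Ioc (-1 : ℝ) 1) :
    greenOne δ x ≤ Phi δ x := by
  rcases lt_or_ge x (-1 + 2 * δ) with hlt | hge
  · refine le_of_tendsto (tendsto_greenTwo hδ hδ1 ⟨hx.1, hlt⟩) ?_
    filter_upwards [Ioc_mem_nhdsGT (sub_neg.2 hδ1)] with α hα
    exact greenTwo_le_Phi hδ hδ1 hα hx.2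
  · rw [greenOne_eq_zero hδ1 ⟨hge, hx.2⟩]
    exact (greenTwo_nonneg (.zero hδ hδ1) x).trans
      (greenTwo_le_Phi hδ hδ1 ⟨sub_neg.2 hδ1, le_rfl⟩ hx.2)

theorem mem_gap_of_greenTwo_pos (h : IsGap δ α) (hx : x ∈ Icc (-1 : ℝ) 1)
    (hpos : 0 < greenTwo α δ x) : x ∈ Ioo (α - δ) (α + δ) := by
  by_contra hgap
  exact hpos.ne' (greenTwo_eq_zero h ⟨hx, hgap⟩)

theorem exists_greenTwo_eq_Phi (hδ : 0 < δ) (hδ1 : δ < 1) (hx : x ∈ Ico (-1 : ℝ) 1)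
    (hlt : greenOne δ x < Phi δ x) : ∃ α ∈ Ioc (δ - 1) 0, greenTwo α δ x = Phi δ x := by
  obtain ⟨m, hgm, hmΦ⟩ := exists_between hlt
  obtain ⟨u, hu, hsub⟩ := mem_nhdsGT_iff_exists_Ioo_subset.1
    ((tendsto_greenOne_half hδ1 tendsto_const_nhds hx.2).eventually_lt_const hgm)
  have hu0 : δ - 1 < min u 0 := lt_min hu (sub_neg.2 hδ1)
  obtain ⟨α, hα, hmax⟩ := (isCompact_Icc (a := min u 0) (b := 0)).exists_isMaxOn
    ⟨0, min_le_right _ _, le_rfl⟩ (f := fun α => greenTwo α δ x) fun α hα =>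
      (continuousAt_greenTwo (.of_mem_Ioc hδ hδ1 ⟨hu0.trans_le hα.1, hα.2⟩)
        ⟨hx.1, hx.2.le⟩).continuousWithinAt
  have hαmem : α ∈ Ioc (δ - 1) 0 := ⟨hu0.trans_le hα.1, hα.2⟩
  have hle : Phi δ x ≤ max m (greenTwo α δ x) := Phi_le hδ1 fun β hβ => by
    rcases lt_or_ge β (min u 0) with hβu | hβu
    · exact le_max_of_le_left ((greenTwo_le_greenOne (.of_mem_Ioc hδ hδ1 hβ) x).trans
        (hsub ⟨hβ.1, hβu.trans_le (min_le_left _ _)⟩).le)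
    · exact le_max_of_le_right (hmax ⟨hβu, hβ.2⟩)
  exact ⟨α, hαmem, (greenTwo_le_Phi hδ hδ1 hαmem hx.2.le).antisymm
    ((le_max_iff.1 hle).resolve_left hmΦ.not_ge)⟩

theorem nonneg_of_hasDerivAt_of_eventually_le {f : ℝ → ℝ} {f' a : ℝ} (hf : HasDerivAt f f' a)
    (hle : ∀ᶠ b in 𝓝[<] a, f b ≤ f a) : 0 ≤ f' := by
  have hslope := (hasDerivAt_iff_tendsto_slope.1 hf).mono_left (nhdsLT_le_nhdsNE a)
  refine ge_of_tendsto hslope ?_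
  filter_upwards [hle, self_mem_nhdsWithin] with b hb hba
  rw [slope_def_field]
  exact div_nonneg_of_nonpos (sub_nonpos.2 hb) (sub_nonpos.2 (le_of_lt hba))

theorem isGapCritical_of_isMaxOn (hδ : 0 < δ) (hδ1 : δ < 1) (hα : α ∈ Ioc (δ - 1) 0) (hx : x ≤ 0)
    (hgap : x ∈ Ioo (α - δ) (α + δ)) (hmax : IsMaxOn (fun β => greenTwo β δ x) (Ioc (δ - 1) 0) α) :
    IsGapCritical δ α x := by
  have hderiv := hasDerivAt_greenTwo (.of_mem_Ioc hδ hδ1 hα) hgap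
  rcases hα.2.lt_or_eq with hneg | rfl
  · have hzero := (hmax.isLocalMax (Ioc_mem_nhds hα.1 hneg)).hasDerivAt_eq_zero hderiv
    exact (isGapCritical_iff (.of_mem_Ioc hδ hδ1 hα)).2 ⟨hgap, hzero⟩
  · have hnonneg := nonneg_of_hasDerivAt_of_eventually_le hderiv
      (mem_of_superset (Ioo_mem_nhdsLT hα.1) fun β hβ => hmax ⟨hβ.1, hβ.2.le⟩)
    have hcrit := isGapCritical_zero_zero (.zero hδ hδ1)
    obtain ⟨hgap0, hzero⟩ := (isGapCritical_iff (.zero hδ hδ1)).1 hcrit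
    have hx0 := ((strictMonoOn_gapVariation_arccos (.zero hδ hδ1)).le_iff_le hgap0 hgap).1
      (hzero.trans_le hnonneg)
    rwa [hx.antisymm hx0]

theorem isGreatest_Phi {x₀ : ℝ → ℝ} (hδ : 0 < δ) (hδ1 : δ < 1)
    (hx₀ : ∀ α ∈ Ioc (δ - 1) 0, ∀ y, IsGapCritical δ α y → y = x₀ α) (hx : x ∈ Ioc (-1 : ℝ) 0) :
    IsGreatest (insert (greenOne δ x)
      ((fun α => greenTwo α δ (x₀ α)) '' {α ∈ Ioc (δ - 1) 0 | x₀ α = x})) (Phi δ x) := by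
  have hx1 : x < 1 := hx.2.trans_lt one_pos
  have hone := greenOne_le_Phi hδ hδ1 ⟨hx.1, hx1.le⟩
  constructor
  · refine hone.eq_or_lt.imp Eq.symm fun hlt => ?_
    obtain ⟨α, hα, hattained⟩ := exists_greenTwo_eq_Phi hδ hδ1 ⟨hx.1.le, hx1⟩ hlt
    have hpos : 0 < Phi δ x := (greenOne_nonneg hδ1 hx1.le).trans_lt hlt
    have hgap := mem_gap_of_greenTwo_pos (.of_mem_Ioc hδ hδ1 hα) ⟨hx.1.le, hx1.le⟩
      (hattained ▸ hpos)
    obtain rfl := hx₀ α hα x (isGapCritical_of_isMaxOn hδ hδ1 hα hx.2 hgap fun β hβ =>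
      (greenTwo_le_Phi hδ hδ1 hβ hx1.le).trans_eq hattained.symm)
    exact ⟨α, ⟨hα, rfl⟩, hattained⟩
  · rintro _ (rfl | ⟨α, ⟨hα, rfl⟩, rfl⟩)
    · exact hone
    · exact greenTwo_le_Phi hδ hδ1 hα hx1.le

theorem Phi_le_greenOne (hδ : 0 < δ) (hx : x ∈ Icc (-1 : ℝ) 1) (hδx : δ + (1 + x) / 2 < 1) :
    Phi δ x ≤ greenOne (δ + (1 + x) / 2) x := by
  have hδ1 : δ < 1 := by linarith [hx.1]
  refine Phi_le hδ1 fun α hα => ?_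
  by_cases hgap : x ∈ Ioo (α - δ) (α + δ)
  · exact (greenTwo_le_greenOne (.of_mem_Ioc hδ hδ1 hα) x).trans
      (greenOne_le_greenOne (by linarith [hgap.1]) hδx hx.2)
  · rw [greenTwo_eq_zero (.of_mem_Ioc hδ hδ1 hα) ⟨hx, hgap⟩]
    exact greenOne_nonneg hδx hx.2

theorem tendsto_Phi (hδ : 0 < δ) (hδ1 : δ < 1) :
    Tendsto (Phi δ) (𝓝[>] (-1)) (𝓝 (greenOne δ (-1))) := by
  have hid : Tendsto (fun x : ℝ => x) (𝓝[>] (-1)) (𝓝 (-1)) := nhdsWithin_le_nhds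
  have hmid : Tendsto (fun x : ℝ => δ + (1 + x) / 2) (𝓝[>] (-1)) (𝓝 δ) := by
    simpa using ((hid.const_add 1).div_const 2).const_add δ
  refine tendsto_of_tendsto_of_tendsto_of_le_of_le'
    (tendsto_greenOne tendsto_const_nhds hid hδ1 (by norm_num))
    (tendsto_greenOne hmid hid hδ1 (by norm_num)) ?_ ?_
  all_goals filter_upwards [hmid.eventually_lt_const hδ1,
    Ioo_mem_nhdsGT (show (-1 : ℝ) < 1 by norm_num)] with x hδx hx
  · exact greenOne_le_Phi hδ hδ1 ⟨hx.1, hx.2.le⟩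
  · exact Phi_le_greenOne hδ ⟨hx.1.le, hx.2.le⟩ hδx

theorem tendsto_isGapCritical {x₀ : ℝ → ℝ} (hδ : 0 < δ) (hδ1 : δ < 1)
    (hx₀ : ∀ α ∈ Ioc (δ - 1) 0, IsGapCritical δ α (x₀ α)) :
    Tendsto x₀ (𝓝[>] (δ - 1)) (𝓝 (-1 + 2 * δ)) := by
  have hα_mem := Ioc_mem_nhdsGT (sub_neg.2 hδ1)
  refine tendsto_order.2 ⟨fun y hy => ?_, fun y hy => ?_⟩
  · obtain ⟨z, hyz, hz⟩ := exists_between (max_lt hy (show (-1 : ℝ) < -1 + 2 * δ by linarith))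
    have hz_mem : z ∈ Ioo (-1) (-1 + 2 * δ) := ⟨(le_max_right _ _).trans_lt hyz, hz⟩
    filter_upwards [eventually_gapVariation_neg hδ hδ1 hz_mem, eventually_mem_gap hz_mem,
      hα_mem] with α hneg hgap hα
    have h := IsGap.of_mem_Ioc hδ hδ1 hα
    obtain ⟨hx₀gap, hzero⟩ := (isGapCritical_iff h).1 (hx₀ α hα)
    have hzx := ((strictMonoOn_gapVariation_arccos h).lt_iff_lt hgap hx₀gap).1
      (hneg.trans_eq hzero.symm)
    exact ((le_max_left _ _).trans_lt hyz).trans hzx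
  · have hright : Tendsto (fun α => α + δ) (𝓝[>] (δ - 1)) (𝓝 (δ - 1 + δ)) :=
      (tendsto_id.mono_left nhdsWithin_le_nhds).add_const δ
    filter_upwards [hright.eventually_lt_const (by linarith), hα_mem] with α hαy hα
    exact (hx₀ α hα).1.2.trans hαy

theorem tendsto_greenTwo_isGapCritical {x₀ : ℝ → ℝ} (hδ : 0 < δ) (hδ1 : δ < 1)
    (hx₀ : ∀ α ∈ Ioc (δ - 1) 0, IsGapCritical δ α (x₀ α)) :
    Tendsto (fun α => greenTwo α δ (x₀ α)) (𝓝[>] (δ - 1)) (𝓝 0) := by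
  have hup := tendsto_greenOne_half hδ1 (tendsto_isGapCritical hδ hδ1 hx₀) (by linarith)
  rw [greenOne_eq_zero hδ1 ⟨le_rfl, by linarith⟩] at hup
  refine squeeze_zero' ?_ ?_ hup
  all_goals
    filter_upwards [Ioc_mem_nhdsGT (sub_neg.2 hδ1)] with α hα
    have h := IsGap.of_mem_Ioc hδ hδ1 hα
  · exact greenTwo_nonneg h _
  · exact greenTwo_le_greenOne h _

end Envelope

end RemezEnvelope

theorem mainTheorem6 (δ : ℝ) (hδ₀ : 0 < δ) (hδ₁ : δ < 1) :
    -- the explicit form of the first curve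
    (∀ x ∈ Set.Icc (-1 : ℝ) 0, x ≤ -1 + 2 * δ →
      RemezEnvelope.greenOne δ x =
        Real.log ((δ - x) / (1 - δ) + Real.sqrt (((δ - x) / (1 - δ)) ^ 2 - 1))) ∧
    (∀ x ∈ Set.Icc (-1 : ℝ) 0, -1 + 2 * δ ≤ x → RemezEnvelope.greenOne δ x = 0) ∧
    ∃ x₀ : ℝ → ℝ,
      -- `x₀ α` is the unique solution in the gap of `∂_α G_{α,δ}(x) = 0`
      (∀ α ∈ Set.Ioc (δ - 1) 0, ∀ x : ℝ, RemezEnvelope.IsGapCritical δ α x ↔ x = x₀ α) ∧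
      -- `Φ_δ` is the upper envelope of the two curves
      (∀ x ∈ Set.Ioc (-1 : ℝ) 0,
        IsGreatest
          (insert (RemezEnvelope.greenOne δ x)
            ((fun α => RemezEnvelope.greenTwo α δ (x₀ α)) '' {α ∈ Set.Ioc (δ - 1) 0 | x₀ α = x}))
          (RemezEnvelope.Phi δ x)) ∧
      -- at the left end point the envelope is the first curve, in the sense of a limit
      Filter.Tendsto (RemezEnvelope.Phi δ) (nhdsWithin (-1) (Set.Ioi (-1)))
        (nhds (RemezEnvelope.greenOne δ (-1))) ∧
      -- the end points of the second curve
      x₀ 0 = 0 ∧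
      RemezEnvelope.greenTwo 0 δ (x₀ 0) = 1 / 2 * Real.log ((1 + δ) / (1 - δ)) ∧
      Filter.Tendsto x₀ (nhdsWithin (-1 + δ) (Set.Ioi (-1 + δ))) (nhds (-1 + 2 * δ)) ∧
      Filter.Tendsto (fun α => RemezEnvelope.greenTwo α δ (x₀ α))
        (nhdsWithin (-1 + δ) (Set.Ioi (-1 + δ))) (nhds 0) := by
  open RemezEnvelope in
  have hzero_mem : (0 : ℝ) ∈ Ioc (δ - 1) 0 := ⟨sub_neg.2 hδ₁, le_rfl⟩
  have hgap₀ := IsGap.zero hδ₀ hδ₁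
  have hunique : ∀ α ∈ Ioc (δ - 1) 0, ∃ x, ∀ y, IsGapCritical δ α y ↔ y = x := fun α hα =>
    (existsUnique_isGapCritical (.of_mem_Ioc hδ₀ hδ₁ hα)).imp fun _ hx y =>
      ⟨hx.2 y, fun h => h ▸ hx.1⟩
  choose! x₀ hx₀ using hunique
  have hcritical α (hα : α ∈ Ioc (δ - 1) 0) : IsGapCritical δ α (x₀ α) := (hx₀ α hα _).2 rfl
  have hx₀zero : x₀ 0 = 0 := ((hx₀ 0 hzero_mem 0).1 (isGapCritical_zero_zero hgap₀)).symm
  rw [neg_add_eq_sub 1 δ]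
  refine ⟨fun x _ hx => greenOne_eq_log hδ₁ hx,
    fun x hx hxδ => greenOne_eq_zero hδ₁ ⟨hxδ, hx.2.trans zero_le_one⟩, x₀, hx₀,
    fun x hx => isGreatest_Phi hδ₀ hδ₁ (fun α hα y => (hx₀ α hα y).1) hx,
    tendsto_Phi hδ₀ hδ₁, hx₀zero, ?_,
    tendsto_isGapCritical hδ₀ hδ₁ hcritical, tendsto_greenTwo_isGapCritical hδ₀ hδ₁ hcritical⟩
  rw [hx₀zero, greenTwo_zero_zero hgap₀, Real.artanh_eq_half_log ⟨by linarith, hδ₁.le⟩]
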